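/- All graphs are finite and simple. For a graph $G$ and a vertex $x$ of $G$, the card $G-x$ is obtained by deleting $x$. For graphs $G,H$, let $b(G,H)$ be the cardinality of the multiset intersection of their decks, i.e. of the multisets of all cards $G-x$ $(x\in V(G))$ and $H-y$ $(y\in V(H))$, taken up to isomorphism. The skeleton of a graph is obtained by deleting all its vertices of degree at most $1$. A sunshine graph is a connected graph whose skeleton is a cycle; a caterpillar is a connected graph whose skeleton is a path. Let $G$ be a graph and $v,w\in V(G)$. For a permutation $\lambda$ of $V(G)$ and induced subgraphs $A,A'$ of $G$, write $\lambda(A)=A'$ if $\lambda$ restricts to an isomorphism from $A$ onto $A'$. Put $$B_{vw}(G)=\{\lambda\in S_{V(G)} : \lambda((G-w)-\lambda^{-1}(v))=(G-v)-\lambda(w)\},$$ $$B^{w}_{vw}(G)=\{\lambda\in B_{vw}(G) : \lambda(G-w)=G-\lambda(w)\}.$$ A maximum saturating set of $B_{vw}(G)$ is a subset $X\subseteq B_{vw}(G)$ such that (a) $1\in X$; (b) $\lambda^{-1}(v)\neq\pi^{-1}(v)$ and $\lambda(w)\neq\pi(w)$ for all distinct $\lambda,\pi\in X$; (c) there is no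 $\sigma\in B_{vw}(G)\setminus X$ such that $X\cup\{\sigma\}$ satisfies (b). Let $\chi_{vw}(G)$ be the maximum of $|X\cap B^{w}_{vw}(G)|$ over all maximum saturating sets $X$ of $B_{vw}(G)$. Theorem. Let $U$ be a sunshine graph and $T$ a caterpillar, where $U$ has order $n\ge 12$. Let $U^+$ be a sunshine graph with vertices $v,w$ such that $U^+-w\cong U$ and $U^+-v\cong T$, chosen so that $\chi_{vw}(U^+)$ is largest possible, i.e. $\chi_{v'w'}(H)\le\chi_{vw}(U^+)$ for every sunshine graph $H$ and all vertices $v',w'$ of $H$ with $H-w'\cong U$ and $H-v'\cong T$. Let $B_U=B^{w}_{vw}(U^+)$ be the set of those active permutations $\lambda \in B_{vw}(U^+)$ that map $U^+-w$ onto the card $U^+-\lambda(w)$ of $U^+$. If $B_U\neq\mathrm{Aut}(U^+)$, then $$b(U,T)\le 2\left\lfloor\sqrt{2n+1}\right\rfloor+3 .$$ -/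

import Mathlib

universe u

namespace Supercard

/-- Two bundled graphs are related when they are isomorphic. -/
def isoSetoid : Setoid ((V : Type u) × SimpleGraph V) where
  r A B := Nonempty (A.2 ≃g B.2)
  iseqv :=
    { refl := fun _ => ⟨SimpleGraph.Iso.refl⟩
      symm := fun ⟨e⟩ => ⟨e.symm⟩
      trans := fun ⟨e⟩ ⟨f⟩ => ⟨f.comp e⟩ }

/-- An unlabelled graph: an isomorphism class of graphs. -/
def UnlabelledGraph : Type (u + 1) := Quotient isoSetoid.{u}

/-- The unlabelled graph underlying `G`. -/
def unlabelled {V : Type u} (G : SimpleGraph V) : UnlabelledGraph.{u} :=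
  Quotient.mk isoSetoid ⟨V, G⟩

/-- The card `G - v`, obtained by deleting the vertex `v`. -/
abbrev card {V : Type u} (G : SimpleGraph V) (v : V) :
    SimpleGraph (({v}ᶜ : Set V) : Type u) :=
  G.induce ({v}ᶜ : Set V)

/-- The deck of `G`: the multiset of all its unlabelled cards. -/
def deck {V : Type u} [Fintype V] (G : SimpleGraph V) : Multiset UnlabelledGraph.{u} :=
  (Finset.univ : Finset V).val.map fun v => unlabelled (card G v)

open Classical in
/-- The number `b(G, H)` of common cards: the cardinality of the multiset intersection
of the two decks. -/
noncomputable def commonCards {V W : Type u} [Fintype V] [Fintype W]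
    (G : SimpleGraph V) (H : SimpleGraph W) : ℕ :=
  Multiset.card (deck G ∩ deck H)

/-- The leaves and isolated vertices of a (finite) graph: the vertices of degree at most one. -/
def leavesAndIsolated {V : Type u} (G : SimpleGraph V) : Set V :=
  {x | (G.neighborSet x).ncard ≤ 1}

/-- The skeleton of `G`: all leaves and isolated vertices are deleted. -/
abbrev skel {V : Type u} (G : SimpleGraph V) :
    SimpleGraph (((leavesAndIsolated G)ᶜ : Set V) : Type u) :=
  G.induce ((leavesAndIsolated G)ᶜ : Set V)

/-- A sunshine graph: a connected graph whose skeleton is a cycle. -/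
def IsSunshine {V : Type u} (G : SimpleGraph V) : Prop :=
  G.Connected ∧ ∃ c : ℕ, 3 ≤ c ∧ Nonempty (skel G ≃g SimpleGraph.cycleGraph c)

/-- A caterpillar: a connected graph whose skeleton is a path. The path on no vertices
is allowed, so that the connected graphs of order at most two are caterpillars. -/
def IsCaterpillar {V : Type u} (G : SimpleGraph V) : Prop :=
  G.Connected ∧ ∃ p : ℕ, Nonempty (skel G ≃g SimpleGraph.pathGraph p)

/-- `G` is a supercard of `A` and `B`, with chosen vertices `v`, `w` such that
`G - w ≅ A` and `G - v ≅ B`. -/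
structure IsSupercardAt {V W X : Type u} (A : SimpleGraph W) (B : SimpleGraph X)
    (G : SimpleGraph V) (v w : V) : Prop where
  card_left : Nonempty (card G w ≃g A)
  card_right : Nonempty (card G v ≃g B)

/-- `lam (G[S]) = G[S']`: the permutation `lam` maps `S` onto `S'` and restricts to an isomorphism
between the subgraphs of `G` induced on `S` and on `S'`. -/
def MapsInduced {V : Type u} (G : SimpleGraph V) (lam : Equiv.Perm V) (S S' : Set V) : Prop :=
  lam '' S = S' ∧ ∀ x ∈ S, ∀ y ∈ S, G.Adj x y ↔ G.Adj (lam x) (lam y)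

/-- The set `B_{vw}(G)` of active permutations:
`lam ((G - w) - lam⁻¹ v) = (G - v) - lam w`. -/
def activePerms {V : Type u} (G : SimpleGraph V) (v w : V) : Set (Equiv.Perm V) :=
  {lam | MapsInduced G lam ({w}ᶜ \ {lam.symm v}) ({v}ᶜ \ {lam w})}

/-- The active permutations that moreover map the card `G - w` onto a card of `G`:
`lam (G - w) = G - lam w`. -/
def activePermsCard {V : Type u} (G : SimpleGraph V) (v w : V) : Set (Equiv.Perm V) :=
  {lam | lam ∈ activePerms G v w ∧ MapsInduced G lam {w}ᶜ {lam w}ᶜ}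

/-- The automorphisms of `G`, as a set of permutations of its vertices. -/
def autPerms {V : Type u} (G : SimpleGraph V) : Set (Equiv.Perm V) :=
  Set.range fun φ : G ≃g G => φ.toEquiv

/-- Distinct members of `X` differ in `lam⁻¹ v` and in `lam w`. -/
def IsSeparated {V : Type u} (v w : V) (X : Set (Equiv.Perm V)) : Prop :=
  ∀ lam ∈ X, ∀ π ∈ X, lam ≠ π → lam.symm v ≠ π.symm v ∧ lam w ≠ π w

/-- Maximum saturating sets of `B_{vw}(G)`. -/
structure IsMaxSaturating {V : Type u} (G : SimpleGraph V) (v w : V)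
    (X : Set (Equiv.Perm V)) : Prop where
  subset : X ⊆ activePerms G v w
  one_mem : (1 : Equiv.Perm V) ∈ X
  separated : IsSeparated v w X
  maximal : ∀ σ ∈ activePerms G v w \ X, ¬ IsSeparated v w (insert σ X)

/-- `χ(G)` (with respect to `v` and `w`): the largest number of members that a maximum saturating
set `X` of `B_{vw}(G)` has in common with `activePermsCard G v w`. -/
noncomputable def chi {V : Type u} (G : SimpleGraph V) (v w : V) : ℕ :=
  sSup {k | ∃ X, IsMaxSaturating G v w X ∧ (X ∩ activePermsCard G v w).ncard = k}

end Supercard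

/-! Write G for the supercard. Its cycle e : ZMod c → V passes through v, which has degree two,
while w is pendant at some e z: a cycle of U must survive the deletion of w, and none survives in
the connected caterpillar G - v. Common cards of U and T form a matching of pairs (x, y), each
realised by a permutation taking (G - w) - x to (G - v) - y with x ↦ v and w ↦ y
(`exists_gluing_matching`). Edge counting gives deg x = deg y + 1 in G - w and G - v, so x lies on
the cycle. For c < 14 this alone bounds the number of pairs by 13, and 13 = 2 · 5 + 3 suffices since
n ≥ 12.

For c ≥ 14, set aside four values of y: the two end vertices of the spine of G - v and one chosen
leaf at each. For every other pair, y is a leaf attached to the spine, and opening the cycle at x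
gives a path that must cover the spine. Its inner vertices are consecutive spine vertices starting
at some e s, with at most two possible values of s. After exchanging twin leaves, the two neighbours
of x go to vertices p and q depending only on s (`IsPointed.classify`). Let H be G - v with v joined
to p and q (`rejoin`). All gluings of type s become isomorphisms from G - w onto cards of H, H is
again a sunshine supercard, and quotients of these gluings are separated active permutations of H
(`card_le_chi_rejoin`). Maximality of χ(G) bounds each type by χ(G). Hence b(U, T) ≤ 4 + 2χ, and
b(U, T) ≤ 4 + χ when both cycle neighbours of v carry pendant vertices, as then only one s is
possible.

It remains to bound χ when some permutation in B_U is not an automorphism. Such permutations act on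
the cycle as rotations or reflections, and the degree sequence a of the cycle in G - w is carried to
itself up to moving one unit. By `dihedral_dichotomy` either at most two rotations and two
reflections occur, or a has a nonzero period. In the latter case all images of w hang at e z, so a
separated set of size k satisfies k ≤ P and k ≤ 2m, with P the number of pendants at e z and m the
number of periods. The period orbits of z and 0 already force m(P + 1) ≤ n, so k(k + 1) ≤ 2n. If a
cycle neighbour of v has no pendant, its orbit is a third one, so k(k + 2) ≤ 2n, that is (k + 1)² ≤
2n + 1. This saves one in χ exactly when both types can occur. -/

namespace Supercard

/-! ### Unit-step sequences and frames of sunshine graphs -/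

/-- A sequence with steps `±1` that never turns back is an arithmetic progression. -/
theorem arithmetic_of_unit_steps {R : Type*} [AddCommGroupWithOne R] (g : ℕ → R) (N : ℕ)
    (h1 : ∀ k < N, g (k + 1) = g k + 1 ∨ g k = g (k + 1) + 1)
    (h2 : ∀ k, k + 2 ≤ N → g (k + 2) ≠ g k) :
    (∀ k ≤ N, g k = g 0 + k) ∨ (∀ k ≤ N, g k = g 0 - k) := by
  have up : (∀ k < N, g (k + 1) = g k + 1) ∨ (∀ k < N, g k = g (k + 1) + 1) := by
    rcases Nat.eq_zero_or_pos N with rfl | hN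
    · left; intro k hk; omega
    · rcases h1 0 hN with h | h
      · left
        intro k
        induction k with
        | zero => intro _; exact h
        | succ k ih =>
          intro hk
          rcases h1 (k + 1) hk with h' | h'
          · exact h'
          · exfalso
            apply h2 k (by omega)
            have := ih (by omega)
            rw [h'] at this
            exact add_right_cancel this
      · right
        intro k
        induction k with
        | zero => intro _; exact h
        | succ k ih =>
          intro hk
          rcases h1 (k + 1) hk with h' | h'
          · exfalso
            apply h2 k (by omega)
            have := ih (by omega)
            rw [h', this]
          · exact h'
  rcases up with h | h
  · left
    intro k
    induction k with
    | zero => intro _; simp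
    | succ k ih =>
      intro hk
      rw [h k hk, ih (by omega)]
      push_cast
      abel
  · right
    intro k
    induction k with
    | zero => intro _; simp
    | succ k ih =>
      intro hk
      have h3 := h k hk
      rw [ih (by omega)] at h3
      rw [eq_sub_of_add_eq h3.symm]
      push_cast
      abel

/-- `e` runs once around a cycle of `G`, and all other vertices are pendant at the cycle. -/
structure IsFrame {V : Type u} (G : SimpleGraph V) {c : ℕ} (e : ZMod c → V) : Prop where
  three_le : 3 ≤ c
  inj : Function.Injective e
  adj : ∀ i j, G.Adj (e i) (e j) ↔ j = i + 1 ∨ i = j + 1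
  pend : ∀ u, u ∉ Set.range e → ∃ i, ∀ u', G.Adj u u' ↔ u' = e i

theorem zmod_natCast_ne_zero {c k : ℕ} (h0 : 0 < k) (hk : k < c) : (k : ZMod c) ≠ 0 := by
  intro h
  rw [ZMod.natCast_eq_zero_iff] at h
  exact absurd (Nat.le_of_dvd h0 h) (by omega)

theorem zmod_two_ne_zero {c : ℕ} (hc : 3 ≤ c) : (2 : ZMod c) ≠ 0 := by
  have := zmod_natCast_ne_zero (c := c) (k := 2) (by omega) (by omega)
  exact_mod_cast this

theorem zmod_add_one_ne_sub_one {c : ℕ} (hc : 3 ≤ c) (i : ZMod c) : i + 1 ≠ i - 1 := by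
  intro h
  apply zmod_two_ne_zero hc
  have : (2 : ZMod c) = (i + 1) - (i - 1) := by ring
  rw [this, h, sub_self]

theorem zmod_natCast_inj {c a b : ℕ} (ha : a < c) (hb : b < c)
    (h : (a : ZMod c) = b) : a = b := by
  have := (ZMod.natCast_eq_natCast_iff' a b c).1 h
  rwa [Nat.mod_eq_of_lt ha, Nat.mod_eq_of_lt hb] at this

/-- A cyclic sequence with steps `±1` that never turns back. -/
theorem exists_add_or_sub_of_unit_steps {c c' : ℕ} (hc' : 3 ≤ c') (g : ZMod c' → ZMod c)
    (hg : Function.Injective g) (h1 : ∀ k, g (k + 1) = g k + 1 ∨ g k = g (k + 1) + 1) :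
    (∀ k : ℕ, g k = g 0 + k) ∨ (∀ k : ℕ, g k = g 0 - k) := by
  have key : ∀ N : ℕ, (∀ k ≤ N, g (k : ℕ) = g 0 + k) ∨ (∀ k ≤ N, g (k : ℕ) = g 0 - k) := by
    intro N
    have := arithmetic_of_unit_steps (fun k : ℕ => g k) N
      (fun k _ => by simpa using h1 (k : ZMod c'))
      (fun k _ h => by
        have := hg h
        push_cast at this
        exact zmod_two_ne_zero hc' (by simpa using this))
    simpa using this
  -- The direction in `key` could depend on N; counterexamples to both directions contradict `key`
  -- at the larger index.
  by_contra! hcon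
  obtain ⟨⟨a, ha⟩, ⟨b, hb⟩⟩ := hcon
  rcases key (max a b) with h | h
  · exact ha (h a (le_max_left _ _))
  · exact hb (h b (le_max_right _ _))

theorem exists_pair_adj_of_two_le {V : Type u} [Finite V] {G : SimpleGraph V} {x : V}
    (h : ¬ (G.neighborSet x).ncard ≤ 1) : ∃ a b, a ≠ b ∧ G.Adj x a ∧ G.Adj x b := by
  rw [not_le, Set.one_lt_ncard] at h
  obtain ⟨a, ha, b, hb, hab⟩ := h
  exact ⟨a, b, hab, ha, hb⟩

theorem two_le_of_pair_adj {V : Type u} [Finite V] {G : SimpleGraph V} {x a b : V}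
    (hab : a ≠ b) (ha : G.Adj x a) (hb : G.Adj x b) : x ∈ (leavesAndIsolated G)ᶜ := by
  intro h
  have h' : (G.neighborSet x).ncard ≤ 1 := h
  rw [Set.ncard_le_one_iff] at h'
  exact hab (h' ha hb)

theorem cycleGraph_adj_iff_add_one {m : ℕ} (i j : ZMod (m + 3)) :
    (SimpleGraph.cycleGraph (m + 3)).Adj (show Fin (m + 3) from i) (show Fin (m + 3) from j) ↔
      j = i + 1 ∨ i = j + 1 := by
  have h1 : (SimpleGraph.cycleGraph (m + 3)).Adj (show Fin (m + 3) from i)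
      (show Fin (m + 3) from j) ↔ i - j = 1 ∨ j - i = 1 := SimpleGraph.cycleGraph_adj
  rw [h1, sub_eq_iff_eq_add, sub_eq_iff_eq_add, add_comm 1 j, add_comm 1 i, or_comm]

/-- The skeleton supplies the cycle. Every other vertex has degree at most one, and connectedness
excludes both an isolated vertex and an isolated edge off the cycle, so its single neighbour is on
the cycle. -/
theorem IsSunshine.exists_frame {V : Type u} [Finite V] {G : SimpleGraph V} (h : IsSunshine G) :
    ∃ (c : ℕ) (e : ZMod c → V), IsFrame G e := by
  obtain ⟨hconn, c, hc, ⟨φ⟩⟩ := h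
  obtain ⟨m, rfl⟩ : ∃ m, c = m + 3 := ⟨c - 3, by omega⟩
  let e : ZMod (m + 3) → V := fun i => (φ.symm (i : Fin (m + 3))).1
  have hadj : ∀ i j, G.Adj (e i) (e j) ↔ j = i + 1 ∨ i = j + 1 := by
    intro i j
    have h1 : G.Adj (e i) (e j) ↔ (SimpleGraph.cycleGraph (m + 3)).Adj i j :=
      φ.symm.map_adj_iff (v := i) (w := j)
    exact h1.trans (cycleGraph_adj_iff_add_one i j)
  have hinj : Function.Injective e := fun i j hij => φ.symm.injective (Subtype.ext hij)
  have hrange : ∀ u, u ∈ (leavesAndIsolated G)ᶜ → u ∈ Set.range e := by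
    intro u hu
    refine ⟨φ ⟨u, hu⟩, ?_⟩
    change (φ.symm (φ ⟨u, hu⟩)).1 = u
    rw [φ.symm_apply_apply]
  have hrange' : ∀ i, e i ∈ (leavesAndIsolated G)ᶜ := fun i => (φ.symm (i : Fin (m + 3))).2
  refine ⟨m + 3, e, hc, hinj, hadj, ?_⟩
  intro u hu
  have hdeg : (G.neighborSet u).ncard ≤ 1 := by
    by_contra hcon
    exact hu (hrange u hcon)
  have huniq : ∀ {x a b}, x ∉ Set.range e → G.Adj x a → G.Adj x b → a = b := by
    intro x a b hx ha hb
    by_contra hab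
    exact hx (hrange x (two_le_of_pair_adj hab ha hb))
  -- A set containing u and closed under adjacency reaches the cycle; it is applied to {u} and to
  -- {u, t}.
  have closed : ∀ S : Set V, u ∈ S → (∀ a ∈ S, ∀ b, G.Adj a b → b ∈ S) → e 0 ∈ S := by
    intro S huS hS
    obtain ⟨p⟩ := hconn.preconnected u (e 0)
    have : ∀ {a b : V} (q : G.Walk a b), a ∈ S → b ∈ S := by
      intro a b q
      induction q with
      | nil => exact id
      | cons hab _ ih => exact fun ha => ih (hS _ ha _ hab)
    exact this p huS
  have hex : ∃ t, G.Adj u t := by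
    by_contra! hcon
    have := closed {u} rfl (fun a ha b hab => by
      rw [Set.mem_singleton_iff] at ha
      subst ha
      exact absurd hab (hcon b))
    exact hu ⟨0, this⟩
  obtain ⟨t, ht⟩ := hex
  have htr : t ∈ Set.range e := by
    by_contra htr
    have := closed {u, t} (by simp) (by
      rintro a (rfl | rfl) b hab
      · right; exact huniq hu hab ht
      · left; exact huniq htr hab ht.symm)
    rcases this with h0 | h0
    · exact hu ⟨0, h0⟩
    · exact htr ⟨0, h0⟩
  obtain ⟨i, rfl⟩ := htr
  refine ⟨i, fun u' => ⟨fun h => huniq hu h ht, ?_⟩⟩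
  rintro rfl
  exact ht

section Frame
variable {V : Type u} {G : SimpleGraph V} {c : ℕ} {e : ZMod c → V}

theorem IsFrame.adj_succ (h : IsFrame G e) (i : ZMod c) : G.Adj (e i) (e (i + 1)) :=
  (h.adj _ _).2 (Or.inl rfl)

theorem IsFrame.adj_pred (h : IsFrame G e) (i : ZMod c) : G.Adj (e i) (e (i - 1)) :=
  (h.adj _ _).2 (Or.inr (by ring))

theorem IsFrame.succ_ne_pred (h : IsFrame G e) (i : ZMod c) : e (i + 1) ≠ e (i - 1) :=
  fun h' => zmod_add_one_ne_sub_one h.three_le i (h.inj h')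

theorem IsFrame.mem_range_of_pair_adj (h : IsFrame G e) {x a b : V} (hab : a ≠ b)
    (ha : G.Adj x a) (hb : G.Adj x b) : x ∈ Set.range e := by
  by_contra hx
  obtain ⟨i, hi⟩ := h.pend x hx
  exact hab (((hi a).1 ha).trans ((hi b).1 hb).symm)

theorem IsFrame.compl_leaves [Finite V] (h : IsFrame G e) :
    (leavesAndIsolated G)ᶜ = Set.range e := by
  ext x
  constructor
  · intro hx
    obtain ⟨a, b, hab, ha, hb⟩ := exists_pair_adj_of_two_le hx
    exact h.mem_range_of_pair_adj hab ha hb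
  · rintro ⟨i, rfl⟩
    exact two_le_of_pair_adj (h.succ_ne_pred i) (h.adj_succ i) (h.adj_pred i)

theorem IsFrame.isSunshine [Finite V] (h : IsFrame G e) : IsSunshine G := by
  have hc := h.three_le
  obtain ⟨m, rfl⟩ : ∃ m, c = m + 3 := ⟨c - 3, by omega⟩
  have hreach : ∀ k : ℕ, G.Reachable (e 0) (e k) := by
    intro k
    induction k with
    | zero => simp
    | succ k ih =>
      refine ih.trans ?_
      push_cast
      exact (h.adj_succ _).reachable
  have hreach' : ∀ i, G.Reachable (e 0) (e i) := by
    intro i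
    have := hreach i.val
    rwa [ZMod.natCast_zmod_val] at this
  have hall : ∀ u, G.Reachable (e 0) u := by
    intro u
    by_cases hu : u ∈ Set.range e
    · obtain ⟨i, rfl⟩ := hu
      exact hreach' i
    · obtain ⟨i, hi⟩ := h.pend u hu
      exact (hreach' i).trans (((hi _).2 rfl).symm).reachable
  have : Nonempty V := ⟨e 0⟩
  refine ⟨⟨fun a b => (hall a).symm.trans (hall b)⟩, m + 3, hc, ?_⟩
  have hs := h.compl_leaves
  let f : Fin (m + 3) ≃ ((leavesAndIsolated G)ᶜ : Set V) :=
    (Equiv.ofInjective (fun i : Fin (m + 3) => e i) h.inj).trans (Equiv.setCongr hs.symm)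
  refine ⟨SimpleGraph.Iso.symm ⟨f, ?_⟩⟩
  intro i j
  exact (h.adj i j).trans (cycleGraph_adj_iff_add_one i j).symm

end Frame

/-! ### Common cards as a matching by gluings -/

/-- A largest common submultiset of two images comes from a matching. -/
theorem exists_matching_of_inter {α β γ : Type*} [DecidableEq α] [DecidableEq β] [DecidableEq γ]
    (f : α → γ) (g : β → γ) (S : Finset α) : ∀ T : Finset β, ∃ M : Finset (α × β),
      M.card = Multiset.card (S.val.map f ∩ T.val.map g) ∧
      (∀ p ∈ M, p.1 ∈ S ∧ p.2 ∈ T ∧ f p.1 = g p.2) ∧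
      (∀ p ∈ M, ∀ q ∈ M, p.1 = q.1 → p = q) ∧ (∀ p ∈ M, ∀ q ∈ M, p.2 = q.2 → p = q) := by
  induction S using Finset.induction_on with
  | empty => intro T; exact ⟨∅, by simp⟩
  | insert a S ha ih =>
    intro T
    rw [Finset.insert_val_of_notMem ha, Multiset.map_cons]
    by_cases h : f a ∈ T.val.map g
    · obtain ⟨b, hb, hgb⟩ := Multiset.mem_map.1 h
      obtain ⟨M, hcard, hM, h1, h2⟩ := ih (T.erase b)
      have hT : (T.val.map g).erase (f a) = (T.erase b).val.map g := by
        have h3 : T.val = b ::ₘ (T.erase b).val := by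
          rw [Finset.erase_val, Multiset.cons_erase hb]
        rw [h3, Multiset.map_cons, hgb, Multiset.erase_cons_head]
      rw [Multiset.cons_inter_of_pos _ h, hT]
      have hnot : (a, b) ∉ M := fun hm => ha (hM _ hm).1
      refine ⟨insert (a, b) M, ?_, ?_, ?_, ?_⟩
      · rw [Finset.card_insert_of_notMem hnot, hcard, Multiset.card_cons]
      · intro p hp
        rcases Finset.mem_insert.1 hp with rfl | hp
        · exact ⟨Finset.mem_insert_self _ _, hb, hgb.symm⟩
        · obtain ⟨h3, h4, h5⟩ := hM p hp
          exact ⟨Finset.mem_insert_of_mem h3, Finset.mem_of_mem_erase h4, h5⟩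
      · intro p hp q hq hpq
        rcases Finset.mem_insert.1 hp with rfl | hp <;> rcases Finset.mem_insert.1 hq with rfl | hq
        · rfl
        · exact absurd ((show a = q.1 from hpq) ▸ (hM q hq).1) ha
        · exact absurd ((show p.1 = a from hpq) ▸ (hM p hp).1) ha
        · exact h1 p hp q hq hpq
      · intro p hp q hq hpq
        rcases Finset.mem_insert.1 hp with rfl | hp <;> rcases Finset.mem_insert.1 hq with rfl | hq
        · rfl
        · exact absurd (show b = q.2 from hpq).symm (Finset.ne_of_mem_erase (hM q hq).2.1)
        · exact absurd (show p.2 = b from hpq) (Finset.ne_of_mem_erase (hM p hp).2.1)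
        · exact h2 p hp q hq hpq
    · rw [Multiset.cons_inter_of_neg _ h]
      obtain ⟨M, hcard, hM, h1, h2⟩ := ih T
      exact ⟨M, hcard, fun p hp => ⟨Finset.mem_insert_of_mem (hM p hp).1, (hM p hp).2⟩, h1, h2⟩

/-- `lam` identifies `(G - w) - x` with `(G - v) - y`. -/
structure IsGluing {V : Type u} (G : SimpleGraph V) (v w x y : V) (lam : Equiv.Perm V) : Prop where
  ne_w : x ≠ w
  ne_v : y ≠ v
  map_x : lam x = v
  map_w : lam w = y
  adj : ∀ a b, a ≠ w → a ≠ x → b ≠ w → b ≠ x → (G.Adj a b ↔ G.Adj (lam a) (lam b))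

/-- Isomorphic cards of two cards of `G` are identified by a permutation of the vertices of `G`. -/
theorem exists_isGluing {V A B : Type u} [Fintype V] {G : SimpleGraph V} {v w : V}
    {U : SimpleGraph A} {T : SimpleGraph B} (eU : card G w ≃g U) (eT : card G v ≃g T)
    {x : A} {y : B} (f : card U x ≃g card T y) :
    ∃ lam, IsGluing G v w (eU.symm x).1 (eT.symm y).1 lam := by
  classical
  set x' : V := (eU.symm x).1 with hx'
  set y' : V := (eT.symm y).1 with hy'
  have hxw : x' ≠ w := (eU.symm x).2
  have hyv : y' ≠ v := (eT.symm y).2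
  have hmem : ∀ u (hu : u ≠ w), u ≠ x' → eU ⟨u, hu⟩ ∈ ({x}ᶜ : Set A) := by
    intro u hu hux h
    apply hux
    have h2 : eU ⟨u, hu⟩ = x := h
    rw [hx', ← h2, eU.symm_apply_apply]
  -- The partial isomorphism is completed on the two deleted vertices by w ↦ y' and x' ↦ v.
  let F : V → V := fun u => if hw : u = w then y' else if hx : u = x' then v else
    (eT.symm (f ⟨eU ⟨u, hw⟩, hmem u hw hx⟩).1).1
  have hFw : F w = y' := by simp [F]
  have hFx : F x' = v := by simp [F, hxw]
  have hF : ∀ u (hw : u ≠ w) (hx : u ≠ x'),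
      F u = (eT.symm (f ⟨eU ⟨u, hw⟩, hmem u hw hx⟩).1).1 := by
    intro u hw hx
    simp [F, hw, hx]
  have hFv : ∀ u, u ≠ w → u ≠ x' → F u ≠ v := by
    intro u hw hx
    rw [hF u hw hx]
    exact (eT.symm _).2
  have hFy : ∀ u, u ≠ w → u ≠ x' → F u ≠ y' := by
    intro u hw hx h
    rw [hF u hw hx, hy'] at h
    exact (f ⟨eU ⟨u, hw⟩, hmem u hw hx⟩).2 (eT.symm.injective (Subtype.ext h))
  have hinj : Function.Injective F := by
    intro a b hab
    by_cases haw : a = w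
    · by_cases hbw : b = w
      · rw [haw, hbw]
      · rw [haw, hFw] at hab
        by_cases hbx : b = x'
        · rw [hbx, hFx] at hab; exact absurd hab hyv
        · exact absurd hab.symm (hFy b hbw hbx)
    · by_cases hax : a = x'
      · rw [hax, hFx] at hab
        by_cases hbw : b = w
        · rw [hbw, hFw] at hab; exact absurd hab.symm hyv
        · by_cases hbx : b = x'
          · rw [hax, hbx]
          · exact absurd hab.symm (hFv b hbw hbx)
      · by_cases hbw : b = w
        · rw [hbw, hFw] at hab; exact absurd hab (hFy a haw hax)
        · by_cases hbx : b = x'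
          · rw [hbx, hFx] at hab; exact absurd hab (hFv a haw hax)
          · rw [hF a haw hax, hF b hbw hbx] at hab
            have h1 := eT.symm.injective (Subtype.ext hab)
            have h2 := f.injective (Subtype.ext h1)
            have h3 := eU.injective (Subtype.ext_iff.1 h2)
            exact Subtype.ext_iff.1 h3
  refine ⟨Equiv.ofBijective F (Finite.injective_iff_bijective.1 hinj), hxw, hyv, hFx, hFw, ?_⟩
  intro a b haw hax hbw hbx
  change _ ↔ G.Adj (F a) (F b)
  rw [hF a haw hax, hF b hbw hbx]
  have h1 : G.Adj a b ↔ U.Adj (eU ⟨a, haw⟩) (eU ⟨b, hbw⟩) :=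
    (eU.map_adj_iff (v := ⟨a, haw⟩) (w := ⟨b, hbw⟩)).symm
  have h2 : U.Adj (eU ⟨a, haw⟩) (eU ⟨b, hbw⟩) ↔
      T.Adj (f ⟨eU ⟨a, haw⟩, hmem a haw hax⟩).1 (f ⟨eU ⟨b, hbw⟩, hmem b hbw hbx⟩).1 :=
    (f.map_adj_iff (v := ⟨eU ⟨a, haw⟩, hmem a haw hax⟩)
      (w := ⟨eU ⟨b, hbw⟩, hmem b hbw hbx⟩)).symm
  rw [h1, h2]
  exact (eT.symm.map_adj_iff).symm

/-- The common cards of two cards of `G` give a matching of their vertices by gluings. -/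
theorem exists_gluing_matching {V A B : Type u} [Fintype V] [Fintype A] [Fintype B]
    {G : SimpleGraph V} {v w : V} {U : SimpleGraph A} {T : SimpleGraph B}
    (h : IsSupercardAt U T G v w) : ∃ M : Finset (V × V), M.card = commonCards U T ∧
      (∀ p ∈ M, ∃ lam, IsGluing G v w p.1 p.2 lam) ∧
      (∀ p ∈ M, ∀ q ∈ M, p.1 = q.1 → p = q) ∧ (∀ p ∈ M, ∀ q ∈ M, p.2 = q.2 → p = q) := by
  classical
  obtain ⟨⟨eU⟩, ⟨eT⟩⟩ := h
  obtain ⟨M, hc, hM, h1, h2⟩ := exists_matching_of_inter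
    (fun x => unlabelled (card U x)) (fun y => unlabelled (card T y)) Finset.univ Finset.univ
  have hUinj : Function.Injective fun x => (eU.symm x).1 :=
    Subtype.val_injective.comp eU.symm.injective
  have hTinj : Function.Injective fun x => (eT.symm x).1 :=
    Subtype.val_injective.comp eT.symm.injective
  refine ⟨M.image fun p => ((eU.symm p.1).1, (eT.symm p.2).1), ?_, ?_, ?_, ?_⟩
  · rw [Finset.card_image_of_injective, hc]
    · unfold commonCards deck
      congr!
    · intro p q hpq
      rw [Prod.mk.injEq] at hpq
      exact Prod.ext (hUinj hpq.1) (hTinj hpq.2)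
  · intro p hp
    obtain ⟨q, hq, rfl⟩ := Finset.mem_image.1 hp
    obtain ⟨f⟩ := Quotient.exact (hM q hq).2.2
    exact exists_isGluing eU eT f
  · intro p hp q hq hpq
    obtain ⟨p', hp', rfl⟩ := Finset.mem_image.1 hp
    obtain ⟨q', hq', rfl⟩ := Finset.mem_image.1 hq
    rw [h1 p' hp' q' hq' (hUinj hpq)]
  · intro p hp q hq hpq
    obtain ⟨p', hp', rfl⟩ := Finset.mem_image.1 hp
    obtain ⟨q', hq', rfl⟩ := Finset.mem_image.1 hq
    rw [h2 p' hp' q' hq' (hTinj hpq)]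

/-! ### Edge counts -/

section Count
variable {V : Type u} [DecidableEq V] (G : SimpleGraph V) [DecidableRel G.Adj]

/-- The number of ordered adjacent pairs in `S`. -/
def adjPairs (S : Finset V) : ℕ := ∑ a ∈ S, ∑ b ∈ S, if G.Adj a b then 1 else 0

theorem adjPairs_erase {S : Finset V} {x : V} (hx : x ∈ S) :
    adjPairs G S = adjPairs G (S.erase x) + 2 * (S.filter (G.Adj x)).card := by
  have hS : S = insert x (S.erase x) := (Finset.insert_erase hx).symm
  have hn : x ∉ S.erase x := Finset.notMem_erase x S
  have h1 : (S.filter (G.Adj x)).card = ∑ b ∈ S.erase x, if G.Adj x b then 1 else 0 := by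
    rw [Finset.card_filter]
    conv_lhs => rw [hS]
    rw [Finset.sum_insert hn]
    simp
  have h2 : ∑ a ∈ S.erase x, (if G.Adj a x then 1 else 0) =
      ∑ b ∈ S.erase x, if G.Adj x b then 1 else 0 :=
    Finset.sum_congr rfl fun a _ => by simp [G.adj_comm a x]
  rw [h1]
  unfold adjPairs
  conv_lhs => rw [hS]
  rw [Finset.sum_insert hn, Finset.sum_insert hn]
  simp_rw [Finset.sum_insert hn]
  rw [Finset.sum_add_distrib, h2]
  simp only [SimpleGraph.irrefl, if_false]
  ring

omit [DecidableEq V] in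
theorem adjPairs_eq_of_map {S S' : Finset V} (lam : Equiv.Perm V)
    (hS : ∀ a, a ∈ S ↔ lam a ∈ S') (h : ∀ a ∈ S, ∀ b ∈ S, (G.Adj a b ↔ G.Adj (lam a) (lam b))) :
    adjPairs G S = adjPairs G S' := by
  have hmap : S' = S.map lam.toEmbedding := by
    ext a
    rw [Finset.mem_map_equiv, hS]
    simp
  unfold adjPairs
  rw [hmap, Finset.sum_map]
  refine Finset.sum_congr rfl fun a ha => ?_
  rw [Finset.sum_map]
  refine Finset.sum_congr rfl fun b hb => ?_
  simp only [Equiv.coe_toEmbedding, h a ha b hb]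

end Count

/-! ### The positions of v and w in the supercard -/

/-- A framed sunshine graph with `v` of degree two on the cycle and `w` pendant at `e z`. -/
structure IsPointed {V : Type u} (G : SimpleGraph V) {c : ℕ} (e : ZMod c → V) (v w : V)
    (z : ZMod c) : Prop extends IsFrame G e where
  base : e 0 = v
  adj_v : ∀ u, G.Adj v u ↔ u = e 1 ∨ u = e (-1)
  adj_w : ∀ u, G.Adj w u ↔ u = e z

section Frame
variable {V : Type u} {G : SimpleGraph V} {c : ℕ} {e : ZMod c → V}

theorem IsFrame.shift (h : IsFrame G e) (j : ZMod c) : IsFrame G fun i => e (i + j) where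
  three_le := h.three_le
  inj := fun a b hab => add_right_cancel (h.inj hab)
  adj := fun a b => by
    rw [h.adj, add_right_comm a, add_right_comm b, add_left_inj, add_left_inj]
  pend := fun u hu => by
    obtain ⟨i, hi⟩ := h.pend u (fun ⟨i, hi⟩ => hu ⟨i - j, by simpa using hi⟩)
    exact ⟨i - j, fun u' => by simpa using hi u'⟩

theorem IsFrame.neg (h : IsFrame G e) : IsFrame G fun i => e (-i) where
  three_le := h.three_le
  inj := fun a b hab => neg_injective (h.inj hab)
  adj := fun a b => by
    rw [h.adj, or_comm]
    refine or_congr ⟨fun h => ?_, fun h => ?_⟩ ⟨fun h => ?_, fun h => ?_⟩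
    · linear_combination h
    · linear_combination h
    · linear_combination h
    · linear_combination h
  pend := fun u hu => by
    obtain ⟨i, hi⟩ := h.pend u (fun ⟨i, hi⟩ => hu ⟨-i, by simpa using hi⟩)
    exact ⟨-i, fun u' => by simpa using hi u'⟩

theorem IsPointed.neg {v w : V} {z : ZMod c} (h : IsPointed G e v w z) :
    IsPointed G (fun i => e (-i)) v w (-z) where
  toIsFrame := h.toIsFrame.neg
  base := by simpa using h.base
  adj_v := fun u => by simpa [or_comm] using h.adj_v u
  adj_w := fun u => by simpa using h.adj_w u

/-- A closed walk around a second frame without backtracking covers the whole cycle. -/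
theorem IsFrame.surjective_of_closed_walk (h : IsFrame G e) {c' : ℕ} (hc' : 3 ≤ c')
    (F : ZMod c' → V) (hF : Function.Injective F) (hadj : ∀ k, G.Adj (F k) (F (k + 1))) :
    ∀ i, e i ∈ Set.range F := by
  have hc := h.three_le
  have : NeZero c := ⟨by omega⟩
  have hr : ∀ k, F k ∈ Set.range e := by
    intro k
    have h1 := hadj (k - 1)
    rw [sub_add_cancel] at h1
    exact h.mem_range_of_pair_adj (fun h' => zmod_add_one_ne_sub_one hc' k (hF h')) (hadj k) h1.symm
  choose g hg using hr
  have hginj : Function.Injective g := fun a b hab => hF (by rw [← hg a, ← hg b, hab])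
  have hstep : ∀ k, g (k + 1) = g k + 1 ∨ g k = g (k + 1) + 1 := by
    intro k
    have := hadj k
    rwa [← hg k, ← hg (k + 1), h.adj] at this
  intro i
  rcases exists_add_or_sub_of_unit_steps hc' g hginj hstep with h1 | h1
  · refine ⟨((i - g 0).val : ℕ), ?_⟩
    rw [← hg, h1, ZMod.natCast_zmod_val, add_sub_cancel]
  · refine ⟨((g 0 - i).val : ℕ), ?_⟩
    rw [← hg, h1, ZMod.natCast_zmod_val, sub_sub_cancel]

/-- The cycle of U sits in G - w, and any cycle of G runs through every frame vertex. -/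
theorem IsFrame.notMem_range_of_sunshine_card [Finite V] (h : IsFrame G e) {w : V}
    {A : Type u} [Finite A] {U : SimpleGraph A} (hU : IsSunshine U) (eU : card G w ≃g U) :
    w ∉ Set.range e := by
  rintro ⟨i, rfl⟩
  obtain ⟨c', f, hf⟩ := hU.exists_frame
  obtain ⟨k, hk⟩ := h.surjective_of_closed_walk hf.three_le (fun k => (eU.symm (f k)).1)
    (Subtype.val_injective.comp (eU.symm.injective.comp hf.inj))
    (fun k => (eU.symm.map_adj_iff (v := f k) (w := f (k + 1))).2 (hf.adj_succ k)) i
  exact (eU.symm (f k)).2 hk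

/-- Otherwise the whole cycle would survive in T, inside its skeleton. That skeleton is a path, and
positions along it cannot return after moving steadily in one direction. -/
theorem IsFrame.mem_range_of_caterpillar_card (h : IsFrame G e) {v : V}
    {B : Type u} [Finite B] {T : SimpleGraph B} (hT : IsCaterpillar T) (eT : card G v ≃g T) :
    v ∈ Set.range e := by
  by_contra hv
  have hc := h.three_le
  obtain ⟨-, p, ⟨φ⟩⟩ := hT
  have hne : ∀ i, e i ∈ ({v}ᶜ : Set V) := fun i hi => hv ⟨i, hi⟩
  let t : ZMod c → B := fun i => eT ⟨e i, hne i⟩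
  have ht : Function.Injective t := fun a b hab =>
    h.inj (Subtype.ext_iff.1 (eT.injective hab))
  have hadj : ∀ i j, G.Adj (e i) (e j) → T.Adj (t i) (t j) := fun i j hij =>
    (eT.map_adj_iff (v := ⟨e i, hne i⟩) (w := ⟨e j, hne j⟩)).2 hij
  have hskel : ∀ i, t i ∈ (leavesAndIsolated T)ᶜ := fun i =>
    two_le_of_pair_adj (fun h' => zmod_add_one_ne_sub_one hc i (ht h'))
      (hadj _ _ (h.adj_succ i)) (hadj _ _ (h.adj_pred i))
  let pos : ZMod c → ℤ := fun i => ((φ ⟨t i, hskel i⟩ : Fin p) : ℕ)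
  have hpos : Function.Injective pos := by
    intro a b hab
    have h1 := Fin.ext (Nat.cast_injective hab)
    exact ht (Subtype.ext_iff.1 (φ.injective h1))
  have hstep : ∀ i, pos (i + 1) = pos i + 1 ∨ pos i = pos (i + 1) + 1 := by
    intro i
    have h1 : (SimpleGraph.pathGraph p).Adj (φ ⟨t i, hskel i⟩) (φ ⟨t (i + 1), hskel (i + 1)⟩) :=
      φ.map_adj_iff.2 (hadj _ _ (h.adj_succ i))
    rw [SimpleGraph.pathGraph_adj] at h1
    simp only [pos]
    omega
  have := arithmetic_of_unit_steps (fun k : ℕ => pos k) c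
    (fun k _ => by simpa using hstep (k : ZMod c))
    (fun k _ h' => by
      have := hpos h'
      push_cast at this
      exact zmod_two_ne_zero hc (by simpa using this))
  -- After c steps the position has changed by c in absolute value, although e c = e 0.
  rcases this with h1 | h1
  · have := h1 c le_rfl
    simp at this
    omega
  · have := h1 c le_rfl
    simp at this
    omega

/-- The frame is rotated so that v sits at index 0. A pendant vertex at v would be isolated in G -
v, contradicting connectedness of T. -/
theorem IsFrame.exists_isPointed [Finite V] (h : IsFrame G e) {v w : V}
    {A B : Type u} [Finite A] [Finite B] {U : SimpleGraph A} {T : SimpleGraph B}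
    (hU : IsSunshine U) (hT : IsCaterpillar T) (hs : IsSupercardAt U T G v w) :
    ∃ (e' : ZMod c → V) (z : ZMod c), IsPointed G e' v w z := by
  obtain ⟨⟨eU⟩, ⟨eT⟩⟩ := hs
  obtain ⟨j, rfl⟩ := h.mem_range_of_caterpillar_card hT eT
  have hw := h.notMem_range_of_sunshine_card hU eU
  obtain ⟨z, hz⟩ := h.pend w hw
  refine ⟨fun i => e (i + j), z - j, h.shift j, by simp, ?_, by simpa using hz⟩
  have hconn : (card G (e j)).Connected := eT.connected_iff.2 hT.1
  intro u
  constructor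
  · intro hu
    by_cases hur : u ∈ Set.range e
    · obtain ⟨i, rfl⟩ := hur
      rcases (h.adj _ _).1 hu with h1 | h1
      · left; rw [h1, add_comm]
      · right; rw [h1]; congr 1; ring
    · exfalso
      obtain ⟨i, hi⟩ := h.pend u hur
      have hij := (hi (e j)).1 hu.symm
      have hne : e (j + 1) ≠ e j := (h.adj_succ j).ne'
      obtain ⟨p⟩ := hconn.preconnected ⟨u, hu.ne'⟩ ⟨e (j + 1), hne⟩
      cases p with
      | nil => exact hur ⟨j + 1, rfl⟩
      | @cons _ b _ hab _ =>
        have h2 : G.Adj u b.1 := hab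
        exact b.2 (((hi _).1 h2).trans hij.symm)
  · rintro (rfl | rfl)
    · rw [add_comm]; exact h.adj_succ j
    · have : -1 + j = j - 1 := by ring
      rw [this]; exact h.adj_pred j

variable {v w : V} {z : ZMod c}

theorem IsPointed.w_notMem (h : IsPointed G e v w z) : w ∉ Set.range e := by
  rintro ⟨i, rfl⟩
  exact h.succ_ne_pred i (((h.adj_w _).1 (h.adj_succ i)).trans ((h.adj_w _).1 (h.adj_pred i)).symm)

theorem IsPointed.e_ne_w (h : IsPointed G e v w z) (i : ZMod c) : e i ≠ w :=
  fun h' => h.w_notMem ⟨i, h'⟩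

theorem IsPointed.z_ne_zero (h : IsPointed G e v w z) : z ≠ 0 := by
  rintro rfl
  have h1 : G.Adj v w := by rw [← h.base]; exact ((h.adj_w _).2 rfl).symm
  rcases (h.adj_v _).1 h1 with h2 | h2
  · exact h.e_ne_w _ h2.symm
  · exact h.e_ne_w _ h2.symm

end Frame

/-! ### Integer sequences almost invariant under rotations and reflections -/

section Dihedral
variable {M : Type*}

section Indicator
variable [DecidableEq M]

theorem eq_or_eq_of_indicator_add {p q t p' q' t' : M}
    (h : ∀ i, ((if i = p then 1 else 0) + (if i = q then 1 else 0) + (if i = t then 1 else 0) : ℤ) =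
      (if i = p' then 1 else 0) + (if i = q' then 1 else 0) + (if i = t' then 1 else 0)) :
    p = p' ∨ p = q' ∨ p = t' := by
  have := h p
  by_contra! hc
  rw [if_pos rfl, if_neg hc.1, if_neg hc.2.1, if_neg hc.2.2] at this
  split_ifs at this <;> omega

theorem eq_or_eq_of_indicator_add_two {p q p' q' : M}
    (h : ∀ i, ((if i = p then 1 else 0) + (if i = q then 1 else 0) : ℤ) =
      (if i = p' then 1 else 0) + (if i = q' then 1 else 0)) :
    p = p' ∨ p = q' := by
  have := h p
  by_contra! hc
  rw [if_pos rfl, if_neg hc.1, if_neg hc.2] at this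
  split_ifs at this <;> omega

end Indicator

variable [AddCommGroup M] [DecidableEq M]

/-- Rotating `a` by `r` moves a unit from `z'` to `z`. -/
def RotMoves (a : M → ℤ) (z r z' : M) : Prop :=
  ∀ i, a (i - r) + (if i = z' then 1 else 0) = a i + (if i = z then 1 else 0)

/-- Reflecting `a` by `i ↦ s - i` moves a unit from `z'` to `z`. -/
def RefMoves (a : M → ℤ) (z s z' : M) : Prop :=
  ∀ i, a (s - i) + (if i = z' then 1 else 0) = a i + (if i = z then 1 else 0)

/-- Rotations commute: evaluating a (i - r₁ - r₂) in both orders leaves an identity between sums of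
three unit masses, and matching the masses gives the alternatives. -/
theorem RotMoves.eq_or_eq {a : M → ℤ} {z r₁ r₂ z₁ z₂ : M} (h₁ : RotMoves a z r₁ z₁)
    (h₂ : RotMoves a z r₂ z₂) (h20 : r₂ ≠ 0) (hne : r₁ ≠ r₂) :
    z₁ = z + r₁ ∨ z₁ = z := by
  have key : ∀ i, ((if i = z + r₂ then 1 else 0) + (if i = z₁ then 1 else 0) +
      (if i = z₂ + r₁ then 1 else 0) : ℤ) = (if i = z + r₁ then 1 else 0) +
      (if i = z₂ then 1 else 0) + (if i = z₁ + r₂ then 1 else 0) := by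
    intro i
    have e1 := h₁ (i - r₂)
    have e2 := h₂ i
    have e3 := h₂ (i - r₁)
    have e4 := h₁ i
    rw [sub_right_comm i r₂ r₁] at e1
    simp only [sub_eq_iff_eq_add] at e1 e2 e3 e4
    linarith
  have k1 := eq_or_eq_of_indicator_add key
  have k2 := eq_or_eq_of_indicator_add (fun i => (key i).symm)
  rcases k2 with h | h | h
  · exact absurd (add_left_cancel h) hne
  · exact Or.inl h.symm
  · have hz : z = z₂ := add_right_cancel h
    rcases k1 with h' | h' | h'
    · exact absurd (add_left_cancel h').symm hne
    · rw [← hz] at h'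
      exact absurd (add_eq_left.1 h') h20
    · exact Or.inr (add_right_cancel h').symm

/-- The two outcomes of `RotMoves.eq_or_eq` say that r₁ is a period of a with a unit added at z, or
of a itself. -/
theorem RotMoves.periodic {a : M → ℤ} {z r₁ r₂ z₁ z₂ : M} (h₁ : RotMoves a z r₁ z₁)
    (h₂ : RotMoves a z r₂ z₂) (h20 : r₂ ≠ 0) (hne : r₁ ≠ r₂) :
    (∀ i, a (i - r₁) + (if i - r₁ = z then 1 else 0) = a i + (if i = z then 1 else 0)) ∨
      ∀ i, a (i - r₁) = a i := by
  rcases h₁.eq_or_eq h₂ h20 hne with rfl | rfl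
  · left
    intro i
    simpa only [show (i - r₁ = z) = (i = z + r₁) from propext sub_eq_iff_eq_add] using h₁ i
  · right
    intro i
    exact add_right_cancel (h₁ i)

/-- Both a + δ_z and its rotation by r₁ have period r, so the difference of unit masses δ_{z₁} -
δ_{z + r₁} has period r too. As r ≠ 0, the two masses coincide. The reflected version below is the
same argument. -/
theorem RotMoves.auto_of_periodic {a : M → ℤ} {z r r₁ z₁ : M} (h₁ : RotMoves a z r₁ z₁)
    (hr : r ≠ 0)
    (hA : ∀ i, a (i - r) + (if i - r = z then 1 else 0) = a i + (if i = z then 1 else 0)) :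
    z₁ = z + r₁ := by
  have key : ∀ i, ((if i = z₁ + r then 1 else 0) + (if i = z + r₁ then 1 else 0) : ℤ) =
      (if i = z₁ then 1 else 0) + (if i = z + r₁ + r then 1 else 0) := by
    intro i
    have e1 := h₁ i
    have e2 := h₁ (i - r)
    have e3 := hA i
    have e4 := hA (i - r₁)
    rw [sub_right_comm i r₁ r] at e4
    simp only [sub_eq_iff_eq_add] at e1 e2 e3 e4
    linarith
  rcases eq_or_eq_of_indicator_add_two key with h | h
  · exact absurd (add_eq_left.1 h) hr
  · exact add_right_cancel h

theorem RefMoves.auto_of_periodic {a : M → ℤ} {z r s z₁ : M} (h₁ : RefMoves a z s z₁)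
    (hr : r ≠ 0)
    (hA : ∀ i, a (i - r) + (if i - r = z then 1 else 0) = a i + (if i = z then 1 else 0)) :
    z₁ = s - z := by
  have key : ∀ i, ((if i = z₁ + r then 1 else 0) + (if i = s - z then 1 else 0) : ℤ) =
      (if i = z₁ then 1 else 0) + (if i = s - z + r then 1 else 0) := by
    intro i
    have e1 := h₁ i
    have e2 := h₁ (i - r)
    have e3 := hA i
    have e4 := hA (s - (i - r))
    have e5 : s - (i - r) - r = s - i := by abel
    have e6 : (s - i = z) = (i = s - z) := propext
      ⟨fun h => by rw [← h]; abel, fun h => by rw [h]; abel⟩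
    have e7 : (s - (i - r) = z) = (i = s - z + r) := propext
      ⟨fun h => by rw [← h]; abel, fun h => by rw [h]; abel⟩
    rw [e5] at e4
    simp only [e6, e7] at e4
    simp only [sub_eq_iff_eq_add] at e1 e2 e3
    linarith
  rcases eq_or_eq_of_indicator_add_two key with h | h
  · exact absurd (add_eq_left.1 h) hr
  · exact add_right_cancel h

/-- If r is a period of a, it is a period of δ_{z₁} - δ_z, which must then vanish. The same holds
for reflections, since a reflected sequence keeps its periods. -/
theorem RotMoves.stab_of_periodic {a : M → ℤ} {z r r₁ z₁ : M} (h₁ : RotMoves a z r₁ z₁)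
    (hr : r ≠ 0) (ha : ∀ i, a (i - r) = a i) : z₁ = z := by
  have key : ∀ i, ((if i = z₁ + r then 1 else 0) + (if i = z then 1 else 0) : ℤ) =
      (if i = z₁ then 1 else 0) + (if i = z + r then 1 else 0) := by
    intro i
    have e1 := h₁ i
    have e2 := h₁ (i - r)
    have e3 := ha i
    have e4 := ha (i - r₁)
    rw [sub_right_comm i r₁ r] at e4
    simp only [sub_eq_iff_eq_add] at e1 e2
    linarith
  rcases eq_or_eq_of_indicator_add_two key with h | h
  · exact absurd (add_eq_left.1 h) hr
  · exact add_right_cancel h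

theorem RefMoves.stab_of_periodic {a : M → ℤ} {z r s z₁ : M} (h₁ : RefMoves a z s z₁)
    (hr : r ≠ 0) (ha : ∀ i, a (i - r) = a i) : z₁ = z := by
  have key : ∀ i, ((if i = z₁ + r then 1 else 0) + (if i = z then 1 else 0) : ℤ) =
      (if i = z₁ then 1 else 0) + (if i = z + r then 1 else 0) := by
    intro i
    have e1 := h₁ i
    have e2 := h₁ (i - r)
    have e3 := ha i
    have e4 := ha (s - (i - r))
    have e5 : s - (i - r) - r = s - i := by abel
    rw [e5] at e4
    simp only [sub_eq_iff_eq_add] at e1 e2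
    linarith
  rcases eq_or_eq_of_indicator_add_two key with h | h
  · exact absurd (add_eq_left.1 h) hr
  · exact add_right_cancel h

/-- Two reflections differ by a rotation of the reflected sequence. -/
theorem RefMoves.rotMoves {a : M → ℤ} {z s₀ s z₀ z₁ : M} (h₀ : RefMoves a z s₀ z₀)
    (h : RefMoves a z s z₁) : RotMoves (fun i => a (s₀ - i)) z₀ (s - s₀) z₁ := by
  intro i
  have e1 := h₀ i
  have e2 := h i
  have e3 : s₀ - (i - (s - s₀)) = s - i := by abel
  simp only [e3]
  linarith

/-- Taking s₀ as reference turns the other two reflections into rotations of the reflected sequence.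
Their common dichotomy is carried back to a by `h₀`. -/
theorem RefMoves.periodic {a : M → ℤ} {z s₀ s₁ s₂ z₀ z₁ z₂ : M} (h₀ : RefMoves a z s₀ z₀)
    (h₁ : RefMoves a z s₁ z₁) (h₂ : RefMoves a z s₂ z₂) (h10 : s₁ ≠ s₀) (h20 : s₂ ≠ s₀)
    (hne : s₁ ≠ s₂) : ∃ r, r ≠ 0 ∧
    ((∀ i, a (i - r) + (if i - r = z then 1 else 0) = a i + (if i = z then 1 else 0)) ∨
      ∀ i, a (i - r) = a i) := by
  refine ⟨s₁ - s₀, sub_ne_zero.2 h10, ?_⟩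
  rcases (h₀.rotMoves h₁).periodic (h₀.rotMoves h₂) (sub_ne_zero.2 h20)
    (fun h => hne (sub_left_injective h)) with h | h
  · left
    intro i
    have e1 := h i
    have e2 := h₀ (i - (s₁ - s₀))
    have e3 := h₀ i
    simp only [sub_eq_iff_eq_add] at e1 e2 ⊢
    linarith
  · right
    intro i
    have := h (s₀ - (i - (s₁ - s₀)))
    simp only [sub_sub_cancel] at this
    rw [← this]
    congr 1
    abel

variable [Fintype M]

open Classical in
/-- The rotations moving at most one unit, the one at `z`. -/
noncomputable def rotSet (a : M → ℤ) (z : M) : Finset M :=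
  Finset.univ.filter fun r => ∃ z', RotMoves a z r z'

open Classical in
/-- The reflections moving at most one unit, the one at `z`. -/
noncomputable def refSet (a : M → ℤ) (z : M) : Finset M :=
  Finset.univ.filter fun s => ∃ z', RefMoves a z s z'

open Classical in
/-- The periods of `a`. -/
noncomputable def periods (a : M → ℤ) : Finset M :=
  Finset.univ.filter fun r => ∀ i, a (i - r) = a i

omit [DecidableEq M] in
theorem mem_periods {a : M → ℤ} {r : M} : r ∈ periods a ↔ ∀ i, a (i - r) = a i := by
  simp [periods]

omit [DecidableEq M] in
theorem sub_mem_periods {a : M → ℤ} {r s : M} (hr : r ∈ periods a) (hs : s ∈ periods a) :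
    r - s ∈ periods a := by
  rw [mem_periods] at *
  intro i
  rw [← hr i, ← hs (i - (r - s))]
  congr 1
  abel

/-- If some rotation or reflection is not a symmetry of `a` with a unit added at `z`, then there
are few of them, or all of them are symmetries of `a`. -/
theorem dihedral_dichotomy (a : M → ℤ) (z : M)
    (hnon : (∃ r z', RotMoves a z r z' ∧ z' ≠ z + r) ∨ ∃ s z', RefMoves a z s z' ∧ z' ≠ s - z) :
    ((rotSet a z).card ≤ 2 ∧ (refSet a z).card ≤ 2) ∨
    (((rotSet a z).card ≤ (periods a).card ∧ (refSet a z).card ≤ (periods a).card) ∧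
      (∀ r z', RotMoves a z r z' → z' = z) ∧ ∀ s z', RefMoves a z s z' → z' = z) := by
  have hA : ∀ r, r ≠ 0 →
      ¬ ∀ i, a (i - r) + (if i - r = z then 1 else 0) = a i + (if i = z then 1 else 0) := by
    intro r hr hA
    rcases hnon with ⟨r', z', h, hz⟩ | ⟨s, z', h, hz⟩
    · exact hz (h.auto_of_periodic hr hA)
    · exact hz (h.auto_of_periodic hr hA)
  by_cases hper : ∃ r, r ≠ 0 ∧ ∀ i, a (i - r) = a i
  · right
    obtain ⟨r, hr, ha⟩ := hper
    have h1 : ∀ r z', RotMoves a z r z' → z' = z := fun r' z' h => h.stab_of_periodic hr ha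
    have h2 : ∀ s z', RefMoves a z s z' → z' = z := fun r' z' h => h.stab_of_periodic hr ha
    refine ⟨⟨Finset.card_le_card fun r' hr' => ?_, ?_⟩, h1, h2⟩
    · simp only [rotSet, Finset.mem_filter, Finset.mem_univ, true_and] at hr'
      obtain ⟨z', h⟩ := hr'
      rw [h1 _ _ h] at h
      exact mem_periods.2 fun i => add_right_cancel (h i)
    · rcases (refSet a z).eq_empty_or_nonempty with h0 | ⟨s₀, h0⟩
      · simp [h0]
      · refine Finset.card_le_card_of_injOn (fun s => s - s₀) (fun s hs => ?_)
          (sub_left_injective.injOn)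
        simp only [refSet, Finset.coe_filter, Finset.mem_filter, Finset.mem_univ, true_and,
          Set.mem_ofPred_eq] at hs h0
        obtain ⟨z', h⟩ := hs
        obtain ⟨z'', h'⟩ := h0
        rw [h2 _ _ h] at h
        rw [h2 _ _ h'] at h'
        refine mem_periods.2 fun i => ?_
        have e1 := add_right_cancel (h (s₀ - (i - (s - s₀))))
        have e2 := add_right_cancel (h' (s₀ - (i - (s - s₀))))
        rw [sub_sub_cancel] at e2
        rw [e2, ← e1]
        congr 1
        abel
  · left
    push Not at hper
    have hno : ∀ r, r ≠ 0 → ¬ ∀ i, a (i - r) = a i := fun r hr h => by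
      obtain ⟨i, hi⟩ := hper r hr
      exact hi (h i)
    constructor
    · by_contra! hcard
      -- At most one nonzero rotation is allowed; the identity rotation accounts for the second
      -- place in the bound.
      have h1 : 1 < ((rotSet a z).erase 0).card := by
        have := Finset.pred_card_le_card_erase (s := rotSet a z) (a := 0)
        omega
      obtain ⟨r₁, hr₁, r₂, hr₂, hne⟩ := Finset.one_lt_card.1 h1
      simp only [rotSet, Finset.mem_erase, Finset.mem_filter, Finset.mem_univ, true_and] at hr₁ hr₂
      obtain ⟨h10, z₁, hz₁⟩ := hr₁
      obtain ⟨h20, z₂, hz₂⟩ := hr₂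
      rcases hz₁.periodic hz₂ h20 hne with h | h
      · exact hA _ h10 h
      · exact hno _ h10 h
    · by_contra! hcard
      obtain ⟨s₀, s₁, s₂, hs₀, hs₁, hs₂, h01, h02, h12⟩ := Finset.two_lt_card_iff.1 hcard
      simp only [refSet, Finset.mem_filter, Finset.mem_univ, true_and] at hs₀ hs₁ hs₂
      obtain ⟨z₀, hz₀⟩ := hs₀
      obtain ⟨z₁, hz₁⟩ := hs₁
      obtain ⟨z₂, hz₂⟩ := hs₂
      obtain ⟨r, hr, h | h⟩ := hz₀.periodic hz₁ hz₂ h01.symm h02.symm h12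
      · exact hA _ hr h
      · exact hno _ hr h

end Dihedral
theorem le_floor_sqrt {k n : ℕ} (h : k * k ≤ 2 * n + 1) : k ≤ ⌊Real.sqrt (2 * (n : ℝ) + 1)⌋₊ := by
  apply Nat.le_floor
  apply Real.le_sqrt_of_sq_le
  have : ((k * k : ℕ) : ℝ) ≤ ((2 * n + 1 : ℕ) : ℝ) := Nat.cast_le.2 h
  push_cast at this
  nlinarith

/-! ### Degrees along the cycle and the upper bound for χ -/

section Degrees
variable {V : Type u} [Fintype V] {G : SimpleGraph V} {c : ℕ} {e : ZMod c → V} {v w : V}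
  {z : ZMod c}

open Classical in
/-- The number of neighbours of `x` other than `p`. -/
noncomputable def degAway (G : SimpleGraph V) (p x : V) : ℕ :=
  ((Finset.univ.erase p).filter (G.Adj x)).card

open Classical in
/-- The number of neighbours of `x`. -/
noncomputable def deg (G : SimpleGraph V) (x : V) : ℕ := (Finset.univ.filter (G.Adj x)).card

open Classical in
theorem degAway_add (G : SimpleGraph V) (p x : V) :
    degAway G p x + (if G.Adj x p then 1 else 0) = deg G x := by
  unfold degAway deg
  rw [← Finset.insert_erase (Finset.mem_univ p), Finset.filter_insert,
    Finset.erase_insert (Finset.notMem_erase _ _)]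
  split_ifs
  · rw [Finset.card_insert_of_notMem (by simp)]
  · rfl

theorem deg_eq_one {x t : V} (h : ∀ u, G.Adj x u ↔ u = t) : deg G x = 1 := by
  classical
  unfold deg
  rw [Finset.card_eq_one]
  refine ⟨t, ?_⟩
  ext u
  simp [h]

theorem adjPairs_univ_eq [DecidableEq V] [DecidableRel G.Adj] (p : V) :
    adjPairs G Finset.univ = adjPairs G (Finset.univ.erase p) + 2 * deg G p := by
  rw [adjPairs_erase G (Finset.mem_univ p)]
  unfold deg
  congr!

/-- Vertices whose cards are isomorphic have the same degree. -/
theorem deg_eq_of_mapsInduced {lam : Equiv.Perm V} {p : V}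
    (h : ∀ x, x ≠ p → ∀ y, y ≠ p → (G.Adj x y ↔ G.Adj (lam x) (lam y))) :
    deg G (lam p) = deg G p := by
  classical
  have h1 := adjPairs_eq_of_map G (S := Finset.univ.erase p) (S' := Finset.univ.erase (lam p)) lam
    (by simp) (by simpa using h)
  have h2 := adjPairs_univ_eq (G := G) p
  have h3 := adjPairs_univ_eq (G := G) (lam p)
  omega

theorem degAway_eq_of_mapsInduced {lam : Equiv.Perm V} {p x : V}
    (h : ∀ x, x ≠ p → ∀ y, y ≠ p → (G.Adj x y ↔ G.Adj (lam x) (lam y))) (hx : x ≠ p) :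
    degAway G (lam p) (lam x) = degAway G p x := by
  classical
  unfold degAway
  symm
  refine Finset.card_bij (fun a _ => lam a) ?_ (fun a _ b _ hab => lam.injective hab) ?_
  · intro a ha
    simp only [Finset.mem_filter, Finset.mem_erase, Finset.mem_univ, and_true] at ha ⊢
    exact ⟨fun h' => ha.1 (lam.injective h'), (h x hx a ha.1).1 ha.2⟩
  · intro b hb
    simp only [Finset.mem_filter, Finset.mem_erase, Finset.mem_univ, and_true] at hb ⊢
    have hne : lam.symm b ≠ p := fun h' => hb.1 (by rw [← h', lam.apply_symm_apply])
    refine ⟨lam.symm b, ⟨hne, ?_⟩, lam.apply_symm_apply b⟩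
    rw [h x hx _ hne, lam.apply_symm_apply]
    exact hb.2

open Classical in
/-- The pendant vertices at `e i`. -/
noncomputable def pendants (G : SimpleGraph V) (e : ZMod c → V) (i : ZMod c) : Finset V :=
  Finset.univ.filter fun u => u ∉ Set.range e ∧ G.Adj (e i) u

theorem mem_pendants {i : ZMod c} {u : V} :
    u ∈ pendants G e i ↔ u ∉ Set.range e ∧ G.Adj (e i) u := by
  simp [pendants]

theorem IsFrame.deg_eq (h : IsFrame G e) (i : ZMod c) :
    deg G (e i) = (pendants G e i).card + 2 := by
  classical
  have h1 : Finset.univ.filter (G.Adj (e i)) =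
      pendants G e i ∪ {e (i + 1), e (i - 1)} := by
    ext u
    simp only [Finset.mem_filter, Finset.mem_univ, true_and, Finset.mem_union, mem_pendants,
      Finset.mem_insert, Finset.mem_singleton]
    constructor
    · intro hu
      by_cases hur : u ∈ Set.range e
      · right
        obtain ⟨j, rfl⟩ := hur
        rcases (h.adj _ _).1 hu with rfl | rfl
        · exact Or.inl rfl
        · right; congr 1; ring
      · exact Or.inl ⟨hur, hu⟩
    · rintro (hu | rfl | rfl)
      · exact hu.2
      · exact h.adj_succ i
      · exact h.adj_pred i
  have h2 : deg G (e i) = (Finset.univ.filter (G.Adj (e i))).card := by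
    unfold deg
    congr!
  rw [h2, h1, Finset.card_union_of_disjoint, Finset.card_pair (h.succ_ne_pred i)]
  rw [Finset.disjoint_left]
  intro u hu hu'
  simp only [Finset.mem_insert, Finset.mem_singleton] at hu'
  rcases hu' with rfl | rfl
  · exact (mem_pendants.1 hu).1 ⟨_, rfl⟩
  · exact (mem_pendants.1 hu).1 ⟨_, rfl⟩

theorem IsFrame.eq_of_mem_pendants (h : IsFrame G e) {i j : ZMod c} {u : V}
    (hi : u ∈ pendants G e i) (hj : u ∈ pendants G e j) : i = j := by
  rw [mem_pendants] at hi hj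
  obtain ⟨k, hk⟩ := h.pend u hi.1
  exact h.inj (((hk _).1 hi.2.symm).trans ((hk _).1 hj.2.symm).symm)

/-- Pendant sets at different cycle vertices are disjoint from each other and from the cycle. -/
theorem IsFrame.sum_le_card [NeZero c] (h : IsFrame G e) :
    ∑ i : ZMod c, ((pendants G e i).card + 1) ≤ Fintype.card V := by
  classical
  have h1 : ∑ i : ZMod c, (pendants G e i).card =
      (Finset.univ.biUnion fun i => pendants G e i).card := by
    rw [Finset.card_biUnion]
    intro i _ j _ hij
    rw [Function.onFun, Finset.disjoint_left]
    exact fun u hu hu' => hij (h.eq_of_mem_pendants hu hu')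
  have h2 : Disjoint (Finset.univ.biUnion fun i => pendants G e i) (Finset.univ.image e) := by
    rw [Finset.disjoint_left]
    intro u hu hu'
    simp only [Finset.mem_biUnion, Finset.mem_univ, true_and, Finset.mem_image] at hu hu'
    obtain ⟨i, hi⟩ := hu
    exact (mem_pendants.1 hi).1 hu'
  have h3 : (Finset.univ.image e).card = ∑ i : ZMod c, 1 := by
    rw [Finset.card_image_of_injective _ h.inj, Finset.card_eq_sum_ones]
  rw [Finset.sum_add_distrib, h1, ← h3, ← Finset.card_union_of_disjoint h2]
  exact Finset.card_le_univ _

theorem IsPointed.mem_pendants_w (h : IsPointed G e v w z) : w ∈ pendants G e z :=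
  mem_pendants.2 ⟨h.w_notMem, ((h.adj_w _).2 rfl).symm⟩

/-- The degrees in `G - w` of the cycle vertices. -/
noncomputable def cycleDeg (G : SimpleGraph V) (e : ZMod c → V) (z i : ZMod c) : ℤ :=
  (deg G (e i) : ℤ) - if i = z then 1 else 0

theorem IsFrame.degAway_pendant (h : IsFrame G e) {p : V} {j : ZMod c}
    (hp : ∀ u, G.Adj p u ↔ u = e j) (i : ZMod c) :
    (degAway G p (e i) : ℤ) = deg G (e i) - if i = j then 1 else 0 := by
  classical
  have h1 := degAway_add G p (e i)
  have h2 : G.Adj (e i) p ↔ i = j := by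
    rw [G.adj_comm, hp]
    exact h.inj.eq_iff
  simp only [h2] at h1
  rw [← h1]
  push_cast
  ring

omit [Fintype V] in
theorem mem_autPerms_iff {lam : Equiv.Perm V} :
    lam ∈ autPerms G ↔ ∀ a b, G.Adj a b ↔ G.Adj (lam a) (lam b) := by
  constructor
  · rintro ⟨φ, rfl⟩ a b
    exact φ.map_adj_iff.symm
  · intro h
    exact ⟨⟨lam, fun {a b} => (h a b).symm⟩, rfl⟩

omit [Fintype V] in
theorem mem_activePermsCard_of_adj {lam : Equiv.Perm V}
    (h : ∀ a, a ≠ w → ∀ b, b ≠ w → (G.Adj a b ↔ G.Adj (lam a) (lam b))) :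
    lam ∈ activePermsCard G v w := by
  refine ⟨⟨?_, fun x hx y hy => h x hx.1 y hy.1⟩, ?_, fun x hx y hy => h x hx y hy⟩
  · ext u
    rw [Equiv.image_eq_preimage_symm]
    simp only [Set.mem_preimage, Set.mem_sdiff, Set.mem_compl_iff, Set.mem_singleton_iff,
      EmbeddingLike.apply_eq_iff_eq, Equiv.symm_apply_eq]
    tauto
  · rw [Set.image_compl_eq lam.bijective, Set.image_singleton]

omit [Fintype V] in
theorem autPerms_subset_activePermsCard : autPerms G ⊆ activePermsCard G v w := fun _ hlam =>
  mem_activePermsCard_of_adj fun a _ b _ => mem_autPerms_iff.1 hlam a b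

/-- A permutation mapping `G - w` onto a card of `G` acts on the cycle by a rotation or a
reflection. -/
theorem IsPointed.dihedral_of_mem (h : IsPointed G e v w z) {lam : Equiv.Perm V}
    (hlam : lam ∈ activePermsCard G v w) :
    ∃ z', (∀ u, G.Adj (lam w) u ↔ u = e z') ∧ lam w ∉ Set.range e ∧
      ((∃ r, RotMoves (cycleDeg G e z) z r z' ∧ lam.symm v = e (-r) ∧
          (z' = z + r → lam ∈ autPerms G)) ∨
        ∃ s, RefMoves (cycleDeg G e z) z s z' ∧ lam.symm v = e s ∧
          (z' = s - z → lam ∈ autPerms G)) := by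
  have hc := h.three_le
  have : NeZero c := ⟨by omega⟩
  have hadj : ∀ x, x ≠ w → ∀ y, y ≠ w → (G.Adj x y ↔ G.Adj (lam x) (lam y)) :=
    fun x hx y hy => hlam.2.2 x hx y hy
  -- The image of w has degree one like w, whereas cycle vertices have degree at least two.
  have hr : lam w ∉ Set.range e := by
    rintro ⟨i, hi⟩
    have h1 := deg_eq_of_mapsInduced hadj
    rw [deg_eq_one h.adj_w, ← hi, h.toIsFrame.deg_eq] at h1
    omega
  obtain ⟨z', hz'⟩ := h.pend _ hr
  have hrange : ∀ i, lam (e i) ∈ Set.range e := by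
    intro i
    refine h.mem_range_of_pair_adj (fun h' => h.succ_ne_pred i (lam.injective h'))
      ((hadj _ (h.e_ne_w _) _ (h.e_ne_w _)).1 (h.adj_succ i))
      ((hadj _ (h.e_ne_w _) _ (h.e_ne_w _)).1 (h.adj_pred i))
  choose g hg using hrange
  have hginj : Function.Injective g := fun a b hab =>
    h.inj (lam.injective (by rw [← hg a, ← hg b, hab]))
  have hstep : ∀ k, g (k + 1) = g k + 1 ∨ g k = g (k + 1) + 1 := by
    intro k
    have := (hadj _ (h.e_ne_w _) _ (h.e_ne_w _)).1 (h.adj_succ k)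
    rwa [← hg k, ← hg (k + 1), h.adj] at this
  have hdeg : ∀ j, cycleDeg G e z j =
      deg G (e (g j)) - if g j = z' then 1 else 0 := by
    intro j
    have h1 := degAway_eq_of_mapsInduced hadj (h.e_ne_w j)
    rw [← hg j] at h1
    have h2 := h.toIsFrame.degAway_pendant h.adj_w j
    have h3 := h.toIsFrame.degAway_pendant hz' (g j)
    rw [h1] at h3
    unfold cycleDeg
    rw [← h2, h3]
  have hmoves : ∀ j, cycleDeg G e z j + (if g j = z' then 1 else 0) =
      cycleDeg G e z (g j) + if g j = z then 1 else 0 := by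
    intro j
    rw [hdeg]
    unfold cycleDeg
    ring
  -- Only the edge at w is not yet controlled; it is preserved when e z is sent to the neighbour of
  -- lam w.
  have haut : g z = z' → lam ∈ autPerms G := by
    rintro rfl
    rw [mem_autPerms_iff]
    have hw : ∀ b, G.Adj w b ↔ G.Adj (lam w) (lam b) := by
      intro b
      rw [h.adj_w, hz', hg, EmbeddingLike.apply_eq_iff_eq]
    intro a b
    by_cases ha : a = w
    · rw [ha]; exact hw b
    · by_cases hb : b = w
      · rw [hb, G.adj_comm, G.adj_comm (lam a)]; exact hw a
      · exact hadj a ha b hb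
  have hv : ∀ j, g j = 0 → lam.symm v = e j := by
    intro j hj
    rw [Equiv.symm_apply_eq, ← hg, hj, h.base]
  refine ⟨z', hz', hr, ?_⟩
  rcases exists_add_or_sub_of_unit_steps hc g hginj hstep with h1 | h1
  · obtain ⟨r, h2⟩ : ∃ r, ∀ i, g i = r + i := by
      refine ⟨g 0, fun i => ?_⟩
      have := h1 i.val
      rwa [ZMod.natCast_zmod_val] at this
    refine Or.inl ⟨r, ?_, ?_, ?_⟩
    · intro i
      have := hmoves (i - r)
      rwa [h2, add_sub_cancel] at this
    · apply hv
      rw [h2]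
      ring
    · intro h3
      apply haut
      rw [h2, h3, add_comm]
  · obtain ⟨s, h2⟩ : ∃ s, ∀ i, g i = s - i := by
      refine ⟨g 0, fun i => ?_⟩
      have := h1 i.val
      rwa [ZMod.natCast_zmod_val] at this
    refine Or.inr ⟨s, ?_, ?_, ?_⟩
    · intro i
      have := hmoves (s - i)
      rwa [h2, sub_sub_cancel] at this
    · apply hv
      rw [h2]
      ring
    · intro h3
      apply haut
      rw [h2, h3]

/-- The numbers a i - 1 are nonnegative and sum to at most |V| - 1. They are constant on cosets of
the periods, each of size m. The coset of z contributes mP and that of 0 contributes m, because v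
has degree two; if e 1 has no pendants, the coset of 1 contributes another m. -/
theorem card_bound_of_periods [NeZero c] (h : IsPointed G e v w z) {k : ℕ} (hk : 5 ≤ k)
    (hP : k ≤ (pendants G e z).card) (hm : k ≤ 2 * (periods (cycleDeg G e z)).card) :
    k * (k + 1) + 2 ≤ 2 * Fintype.card V ∧
      (pendants G e 1 = ∅ → k * (k + 2) + 2 ≤ 2 * Fintype.card V) := by
  classical
  set a := cycleDeg G e z with ha
  set P := (pendants G e z).card with hPdef
  set m := (periods a).card with hmdef
  have hsum : ∑ i : ZMod c, (a i - 1) ≤ (Fintype.card V : ℤ) - 1 := by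
    -- Each cycle vertex counts itself and its pendants; the final -1 removes w.
    have h1 : ∑ i : ZMod c, (a i - 1) = (∑ i : ZMod c, ((pendants G e i).card + 1) : ℕ) - 1 := by
      push_cast
      have h2 : ∀ i : ZMod c, a i - 1 = ((pendants G e i).card + 1 : ℤ) - if i = z then 1 else 0 := by
        intro i
        rw [ha]
        unfold cycleDeg
        rw [h.toIsFrame.deg_eq]
        push_cast
        ring
      rw [Finset.sum_congr rfl fun i _ => h2 i, Finset.sum_sub_distrib]
      simp
    rw [h1]
    have := h.toIsFrame.sum_le_card
    have h3 : ((∑ i : ZMod c, ((pendants G e i).card + 1) : ℕ) : ℤ) ≤ Fintype.card V := by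
      exact_mod_cast this
    linarith
  have hz : a z - 1 = P := by
    rw [ha]
    unfold cycleDeg
    rw [h.toIsFrame.deg_eq, if_pos rfl]
    push_cast
    ring
  have hpos : ∀ i, 0 ≤ a i - 1 := by
    intro i
    rw [ha]
    unfold cycleDeg
    rw [h.toIsFrame.deg_eq]
    push_cast
    split_ifs <;> linarith [(Nat.cast_nonneg (pendants G e i).card : (0 : ℤ) ≤ _)]
  have hempty : ∀ i, i ≠ z → pendants G e i = ∅ → a i - 1 = 1 := by
    intro i hi hp
    rw [ha]
    unfold cycleDeg
    rw [h.toIsFrame.deg_eq, hp, if_neg hi]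
    simp
  have ha0 : a 0 - 1 = 1 := by
    refine hempty 0 h.z_ne_zero.symm ?_
    rw [Finset.eq_empty_iff_forall_notMem]
    intro u hu
    rw [mem_pendants, h.base, h.adj_v] at hu
    rcases hu with ⟨h1, rfl | rfl⟩ <;> exact h1 ⟨_, rfl⟩
  have hshift : ∀ t, ∀ i ∈ (periods a).image (t + ·), a i = a t := by
    intro t i hi
    obtain ⟨r, hr, rfl⟩ := Finset.mem_image.1 hi
    have := mem_periods.1 hr (t + r)
    rw [add_sub_cancel_right] at this
    exact this.symm
  have hcard : ∀ t, ((periods a).image (t + ·)).card = m := fun t =>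
    Finset.card_image_of_injective _ (add_right_injective t)
  have hS : ∀ t, ∑ i ∈ (periods a).image (t + ·), (a i - 1) = m * (a t - 1) := by
    intro t
    rw [Finset.sum_congr rfl fun i hi => by rw [hshift t i hi], Finset.sum_const, hcard,
      nsmul_eq_mul]
  -- A coset on which a i - 1 is 1 cannot meet the coset of z, where the value is P ≥ k ≥ 5.
  have hdisj : ∀ t, a t - 1 = 1 →
      Disjoint ((periods a).image (z + ·)) ((periods a).image (t + ·)) := by
    intro t ht
    rw [Finset.disjoint_left]
    intro i hi hi'
    have h1 := hshift z i hi
    have h2 := hshift t i hi'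
    have : (5 : ℤ) ≤ P := by exact_mod_cast hk.trans hP
    linarith
  have hkm : (k : ℤ) ≤ 2 * m := by exact_mod_cast hm
  have hkP : (k : ℤ) ≤ P := by exact_mod_cast hP
  constructor
  · have h1 : ∑ i ∈ (periods a).image (z + ·) ∪ (periods a).image (0 + ·), (a i - 1) ≤
        ∑ i : ZMod c, (a i - 1) :=
      Finset.sum_le_sum_of_subset_of_nonneg (Finset.subset_univ _) fun i _ _ => hpos i
    rw [Finset.sum_union (hdisj 0 ha0), hS, hS, hz, ha0] at h1
    zify
    nlinarith
  · intro hp1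
    have h1z : (1 : ZMod c) ≠ z := by
      rintro rfl
      have := h.mem_pendants_w
      rw [hp1] at this
      simp at this
    have ha1 := hempty 1 h1z hp1
    -- If the cosets of 0 and 1 met, 1 would be a period and a constant, contradicting its values at
    -- 0 and z.
    have hdisj' : Disjoint ((periods a).image (0 + ·)) ((periods a).image (1 + ·)) := by
      rw [Finset.disjoint_left]
      intro i hi hi'
      obtain ⟨r, hr, rfl⟩ := Finset.mem_image.1 hi
      obtain ⟨s, hs, hrs⟩ := Finset.mem_image.1 hi'
      have h1 : (1 : ZMod c) ∈ periods a := by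
        have := sub_mem_periods hr hs
        rwa [show r - s = (1 : ZMod c) by simp only [zero_add] at hrs; rw [← hrs]; ring] at this
      have hconst : ∀ j : ℕ, a j = a 0 := by
        intro j
        induction j with
        | zero => simp
        | succ j ih =>
          rw [← ih, ← mem_periods.1 h1 ((j + 1 : ℕ) : ZMod c)]
          push_cast
          rw [add_sub_cancel_right]
      have := hconst z.val
      rw [ZMod.natCast_zmod_val] at this
      have : (5 : ℤ) ≤ P := by exact_mod_cast hk.trans hP
      linarith
    have h1 : ∑ i ∈ ((periods a).image (z + ·) ∪ (periods a).image (0 + ·)) ∪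
        (periods a).image (1 + ·), (a i - 1) ≤ ∑ i : ZMod c, (a i - 1) :=
      Finset.sum_le_sum_of_subset_of_nonneg (Finset.subset_univ _) fun i _ _ => hpos i
    rw [Finset.sum_union (Finset.disjoint_union_left.2 ⟨hdisj 1 ha1, hdisj'⟩),
      Finset.sum_union (hdisj 0 ha0), hS, hS, hS, hz, ha0, ha1] at h1
    zify
    nlinarith

/-- If some permutation mapping `G - w` onto a card of `G` is not an automorphism of `G`, then a
separated set of such permutations is small. -/
theorem IsPointed.ncard_le (h : IsPointed G e v w z)
    (hne : activePermsCard G v w ≠ autPerms G) {X : Set (Equiv.Perm V)}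
    (hX : X ⊆ activePermsCard G v w) (hsep : IsSeparated v w X) :
    X.ncard ≤ 4 ∨ (X.ncard * (X.ncard + 1) + 2 ≤ 2 * Fintype.card V ∧
      (pendants G e 1 = ∅ → X.ncard * (X.ncard + 2) + 2 ≤ 2 * Fintype.card V)) := by
  classical
  have : NeZero c := ⟨by have := h.three_le; omega⟩
  obtain ⟨μ, hμ, hμ'⟩ : ∃ μ ∈ activePermsCard G v w, μ ∉ autPerms G := by
    by_contra! hcon
    exact hne (Set.Subset.antisymm hcon autPerms_subset_activePermsCard)
  set a := cycleDeg G e z with ha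
  have hnon : (∃ r z', RotMoves a z r z' ∧ z' ≠ z + r) ∨ ∃ s z', RefMoves a z s z' ∧ z' ≠ s - z := by
    obtain ⟨z', -, -, ⟨r, h1, -, h2⟩ | ⟨s, h1, -, h2⟩⟩ := h.dihedral_of_mem hμ
    · exact Or.inl ⟨r, z', h1, fun h3 => hμ' (h2 h3)⟩
    · exact Or.inr ⟨s, z', h1, fun h3 => hμ' (h2 h3)⟩
  have hcount : X.ncard ≤ (rotSet a z).card + (refSet a z).card := by
    -- Separation makes the preimage of v injective on X, and that preimage is determined by the
    -- rotation or reflection.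
    have h1 : X.ncard ≤ (((rotSet a z).image fun r => e (-r)) ∪ (refSet a z).image e).card := by
      rw [← Set.ncard_coe_finset]
      refine Set.ncard_le_ncard_of_injOn (fun lam => lam.symm v) ?_ ?_
      · intro lam hlam
        rw [Finset.coe_union, Set.mem_union, Finset.mem_coe, Finset.mem_coe, Finset.mem_image,
          Finset.mem_image]
        obtain ⟨z', -, -, ⟨r, h1, h2, -⟩ | ⟨s, h1, h2, -⟩⟩ := h.dihedral_of_mem (hX hlam)
        · exact Or.inl ⟨r, by simp only [rotSet, Finset.mem_filter, Finset.mem_univ, true_and];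
                              exact ⟨z', h1⟩, h2.symm⟩
        · exact Or.inr ⟨s, by simp only [refSet, Finset.mem_filter, Finset.mem_univ, true_and];
                              exact ⟨z', h1⟩, h2.symm⟩
      · intro lam hlam π hπ hlp
        by_contra hne'
        exact (hsep lam hlam π hπ hne').1 hlp
    exact h1.trans ((Finset.card_union_le _ _).trans
      (add_le_add Finset.card_image_le Finset.card_image_le))
  rcases dihedral_dichotomy a z hnon with ⟨h1, h2⟩ | ⟨⟨h1, h2⟩, h3, h4⟩
  · left; omega
  · by_cases h5 : X.ncard ≤ 4
    · exact Or.inl h5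
    · right
      refine card_bound_of_periods h (by omega) ?_
        (show _ ≤ 2 * (periods a).card by omega)
      -- Here every z' equals z, so by separation the images of w are distinct pendants at e z.
      rw [← Set.ncard_coe_finset]
      refine Set.ncard_le_ncard_of_injOn (fun lam => lam w) ?_ ?_
      · intro lam hlam
        obtain ⟨z', h6, h7, h8⟩ := h.dihedral_of_mem (hX hlam)
        have : z' = z := by
          rcases h8 with ⟨r, h8, -⟩ | ⟨s, h8, -⟩
          · exact h3 _ _ h8
          · exact h4 _ _ h8
        subst this
        exact Finset.mem_coe.2 (mem_pendants.2 ⟨h7, ((h6 _).2 rfl).symm⟩)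
      · intro lam hlam π hπ hlp
        by_contra hne'
        exact (hsep lam hlam π hπ hne').2 hlp

omit [Fintype V] in
theorem chi_le_of_forall {k : ℕ}
    (hk : ∀ X : Set (Equiv.Perm V), X ⊆ activePermsCard G v w → IsSeparated v w X → X.ncard ≤ k) :
    chi G v w ≤ k := by
  apply csSup_le'
  rintro _ ⟨X, hX, rfl⟩
  exact hk _ Set.inter_subset_right fun a ha b hb => hX.separated a ha.1 b hb.1

theorem IsPointed.chi_le (h : IsPointed G e v w z)
    (hne : activePermsCard G v w ≠ autPerms G) {n : ℕ} (hn : Fintype.card V = n + 1)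
    (hn12 : 12 ≤ n) : chi G v w ≤ ⌊Real.sqrt (2 * (n : ℝ) + 1)⌋₊ := by
  apply chi_le_of_forall
  intro X hX hsep
  apply le_floor_sqrt
  rcases h.ncard_le hne hX hsep with h1 | ⟨h1, -⟩
  · nlinarith
  · rw [hn] at h1
    nlinarith

/-- The extra coset gives k(k + 2) ≤ 2n for separated sets of size k > 4, and k(k + 2) + 1 = (k +
1)². For k ≤ 4 it is enough that 5² ≤ 2n + 1. -/
theorem IsPointed.chi_add_one_le (h : IsPointed G e v w z)
    (hne : activePermsCard G v w ≠ autPerms G) {n : ℕ} (hn : Fintype.card V = n + 1)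
    (hn12 : 12 ≤ n) (hp : pendants G e 1 = ∅) :
    chi G v w + 1 ≤ ⌊Real.sqrt (2 * (n : ℝ) + 1)⌋₊ := by
  have h5 : 5 ≤ ⌊Real.sqrt (2 * (n : ℝ) + 1)⌋₊ := le_floor_sqrt (by omega)
  suffices chi G v w ≤ ⌊Real.sqrt (2 * (n : ℝ) + 1)⌋₊ - 1 by omega
  apply chi_le_of_forall
  intro X hX hsep
  rcases h.ncard_le hne hX hsep with h1 | ⟨-, h1⟩
  · omega
  · have := h1 hp
    rw [hn] at this
    have h2 : X.ncard + 1 ≤ ⌊Real.sqrt (2 * (n : ℝ) + 1)⌋₊ := le_floor_sqrt (by nlinarith)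
    omega

end Degrees

/-! ### Lower bounds for χ from separated sets -/

section Chi
variable {V : Type u} [Fintype V] {G : SimpleGraph V} {v w : V}

theorem exists_isMaxSaturating {X₀ : Set (Equiv.Perm V)} (h1 : 1 ∈ X₀)
    (hact : X₀ ⊆ activePerms G v w) (hsep : IsSeparated v w X₀) :
    ∃ X, X₀ ⊆ X ∧ IsMaxSaturating G v w X := by
  let s : Set (Set (Equiv.Perm V)) :=
    {X | X ⊆ activePerms G v w ∧ 1 ∈ X ∧ IsSeparated v w X}
  obtain ⟨X, hle, hX⟩ := (Set.toFinite s).exists_le_maximal (show X₀ ∈ s from ⟨hact, h1, hsep⟩)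
  refine ⟨X, hle, hX.prop.1, hX.prop.2.1, hX.prop.2.2, fun σ hσ hs => hσ.2 ?_⟩
  exact hX.le_of_ge (y := insert σ X)
    ⟨Set.insert_subset hσ.1 hX.prop.1, Set.mem_insert_of_mem _ hX.prop.2.1, hs⟩
    (Set.subset_insert _ _) (Set.mem_insert _ _)

/-- A separated set containing 1 extends to a maximum saturating set, since there are finitely many
permutations. Finiteness also bounds the supremum defining χ. -/
theorem ncard_le_chi {X₀ : Set (Equiv.Perm V)} (h1 : 1 ∈ X₀)
    (hact : X₀ ⊆ activePermsCard G v w) (hsep : IsSeparated v w X₀) :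
    X₀.ncard ≤ chi G v w := by
  obtain ⟨X, hle, hX⟩ := exists_isMaxSaturating h1 (fun a ha => (hact ha).1) hsep
  have h2 : X₀.ncard ≤ (X ∩ activePermsCard G v w).ncard :=
    Set.ncard_le_ncard (Set.subset_inter hle hact) (Set.toFinite _)
  refine h2.trans (le_csSup ⟨(Set.univ : Set (Equiv.Perm V)).ncard, ?_⟩ ⟨X, hX, rfl⟩)
  rintro _ ⟨Y, -, rfl⟩
  exact Set.ncard_le_ncard (Set.subset_univ _) (Set.toFinite _)

end Chi

/-! ### Reattaching v to obtain competing supercards -/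

/-- `G` with the neighbourhood of `v` replaced by `{p, q}`. -/
def rejoin {V : Type u} (G : SimpleGraph V) (v p q : V) : SimpleGraph V :=
  SimpleGraph.fromRel fun a b => (a ≠ v ∧ b ≠ v ∧ G.Adj a b) ∨ (a = v ∧ (b = p ∨ b = q))

section Rejoin
variable {V : Type u} {G : SimpleGraph V} {v w p q : V}

theorem rejoin_adj_of_ne {a b : V} (ha : a ≠ v) (hb : b ≠ v) :
    (rejoin G v p q).Adj a b ↔ G.Adj a b := by
  rw [rejoin, SimpleGraph.fromRel_adj]
  have h1 := G.adj_comm a b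
  have h2 : G.Adj a b → a ≠ b := fun h => h.ne
  tauto

theorem rejoin_adj_v (hp : p ≠ v) (hq : q ≠ v) {b : V} :
    (rejoin G v p q).Adj v b ↔ b = p ∨ b = q := by
  rw [rejoin, SimpleGraph.fromRel_adj]
  constructor
  · tauto
  · rintro (rfl | rfl)
    · exact ⟨hp.symm, by tauto⟩
    · exact ⟨hq.symm, by tauto⟩

/-- `lam` glues `(G - w) - x` to `(G - v) - y` so that the neighbours of `x` go to `p` and `q`. -/
structure IsGluingAlong (G : SimpleGraph V) (v w p q x y : V) (lam : Equiv.Perm V) : Prop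
    extends IsGluing G v w x y lam where
  nbr : ∀ b, b ≠ w → (G.Adj x b ↔ lam b = p ∨ lam b = q)

/-- This is the purpose of `rejoin`: prescribing the images of the neighbours of x upgrades a gluing
to an isomorphism from G - w onto the card of the rejoined graph at y. -/
theorem IsGluingAlong.adj_iff {x y : V} {lam : Equiv.Perm V} (hp : p ≠ v) (hq : q ≠ v)
    (h : IsGluingAlong G v w p q x y lam) {a b : V} (ha : a ≠ w) (hb : b ≠ w) :
    G.Adj a b ↔ (rejoin G v p q).Adj (lam a) (lam b) := by
  have hx : ∀ a, a ≠ x → lam a ≠ v := fun a ha h' => ha (lam.injective (h'.trans h.map_x.symm))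
  by_cases hax : a = x
  · rw [hax, h.map_x, rejoin_adj_v hp hq]
    exact h.nbr b hb
  · by_cases hbx : b = x
    · rw [hbx, h.map_x, G.adj_comm, (rejoin G v p q).adj_comm, rejoin_adj_v hp hq]
      exact h.nbr a ha
    · rw [rejoin_adj_of_ne (hx a hax) (hx b hbx)]
      exact h.adj a b ha hax hb hbx

/-- A permutation preserving adjacency off `w` gives an isomorphism of cards. -/
theorem nonempty_card_iso {H : SimpleGraph V} {lam : Equiv.Perm V}
    (h : ∀ a, a ≠ w → ∀ b, b ≠ w → (G.Adj a b ↔ H.Adj (lam a) (lam b))) :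
    Nonempty (card G w ≃g card H (lam w)) := by
  refine ⟨⟨lam.subtypeEquiv fun a => ?_, ?_⟩⟩
  · simp
  · intro a b
    exact (h a.1 a.2 b.1 b.2).symm

/-- The cycle of G - w is transported by `lam`, and only y must be added. It is pendant at t, so it
suffices that t is on the transported cycle. -/
theorem IsGluingAlong.isFrame {c : ℕ} {e : ZMod c → V} {z : ZMod c} (hG : IsPointed G e v w z)
    {x y t : V} {lam : Equiv.Perm V} (hp : p ≠ v) (hq : q ≠ v)
    (h : IsGluingAlong G v w p q x y lam) (ht : ∀ u, u ≠ v → (G.Adj y u ↔ u = t)) (htv : t ≠ v)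
    (hyp : y ≠ p) (hyq : y ≠ q)
    (ht2 : ∃ a b, a ≠ b ∧ a ≠ v ∧ b ≠ v ∧ a ≠ y ∧ b ≠ y ∧ G.Adj t a ∧ G.Adj t b) :
    IsFrame (rejoin G v p q) fun i => lam (e i) := by
  have hy : ∀ u, (rejoin G v p q).Adj y u ↔ u = t := by
    intro u
    by_cases hu : u = v
    · rw [hu, (rejoin G v p q).adj_comm, rejoin_adj_v hp hq]
      constructor
      · tauto
      · intro h'; exact absurd h'.symm htv
    · rw [rejoin_adj_of_ne h.ne_v hu, ht u hu]
  -- The vertex t keeps two neighbours other than v and y, so its preimage has two neighbours in G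
  -- and is on the cycle.
  have htr : ∃ i, lam (e i) = t := by
    obtain ⟨a, b, hab, hav, hbv, hay, hby, hta, htb⟩ := ht2
    have hty : t ≠ y := ((ht t htv).2 rfl).ne'
    have hsw : ∀ {u}, u ≠ y → lam.symm u ≠ w := fun {u} hu h' => hu (by
      rw [← h.map_w, ← h', lam.apply_symm_apply])
    have hadj : ∀ {u}, u ≠ v → u ≠ y → G.Adj t u → G.Adj (lam.symm t) (lam.symm u) := by
      intro u huv huy htu
      rw [h.adj_iff hp hq (hsw hty) (hsw huy), lam.apply_symm_apply, lam.apply_symm_apply,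
        rejoin_adj_of_ne htv huv]
      exact htu
    obtain ⟨i, hi⟩ := hG.mem_range_of_pair_adj (fun h' => hab (lam.symm.injective h'))
      (hadj hav hay hta) (hadj hbv hby htb)
    exact ⟨i, by rw [hi, lam.apply_symm_apply]⟩
  refine ⟨hG.three_le, lam.injective.comp hG.inj, ?_, ?_⟩
  · intro i j
    rw [← h.adj_iff hp hq (hG.e_ne_w i) (hG.e_ne_w j), hG.adj]
  · intro u hu
    by_cases huy : u = y
    · obtain ⟨i, hi⟩ := htr
      rw [huy]
      exact ⟨i, fun u' => by rw [hy, hi]⟩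
    · obtain ⟨a, rfl⟩ := lam.surjective u
      have haw : a ≠ w := by rintro rfl; exact huy h.map_w
      obtain ⟨i, hi⟩ := hG.pend a (fun ⟨i, hi⟩ => hu ⟨i, by rw [← hi]⟩)
      refine ⟨i, fun u' => ?_⟩
      obtain ⟨b, rfl⟩ := lam.surjective u'
      by_cases hb : b = w
      · rw [hb, h.map_w, (rejoin G v p q).adj_comm, hy, ← h.map_w, EmbeddingLike.apply_eq_iff_eq]
        constructor
        · intro h'
          obtain ⟨j, hj⟩ := htr
          exact absurd ⟨j, hj.trans h'.symm⟩ hu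
        · intro h'
          exact absurd h'.symm (hG.e_ne_w i)
      · rw [← h.adj_iff hp hq haw hb, hi, EmbeddingLike.apply_eq_iff_eq]

/-- Matched pairs glued along the same `{p, q}` give a separated set for the rejoined graph. -/
theorem card_le_chi_rejoin [Fintype V] {M : Finset (V × V)} (hp : p ≠ v) (hq : q ≠ v)
    (hM : ∀ m ∈ M, ∃ lam, IsGluingAlong G v w p q m.1 m.2 lam)
    (h1 : ∀ m ∈ M, ∀ m' ∈ M, m.1 = m'.1 → m = m') (h2 : ∀ m ∈ M, ∀ m' ∈ M, m.2 = m'.2 → m = m')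
    {m₀ : V × V} (hm₀ : m₀ ∈ M) : M.card ≤ chi (rejoin G v p q) v m₀.2 := by
  classical
  choose! L hL using hM
  -- Following the inverse of one fixed gluing by another carries the card of the rejoined graph at
  -- m₀.2 to its card at m.2.
  let F : V × V → Equiv.Perm V := fun m => L m * (L m₀)⁻¹
  have hFv : ∀ m ∈ M, (F m).symm v = L m₀ m.1 := by
    intro m hm
    rw [Equiv.symm_apply_eq]
    simp [F, (hL m hm).map_x]
  have hFy : ∀ m ∈ M, F m m₀.2 = m.2 := by
    intro m hm
    have : (L m₀)⁻¹ m₀.2 = w := by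
      rw [Equiv.Perm.inv_eq_iff_eq]
      exact (hL m₀ hm₀).map_w.symm
    simp only [F, Equiv.Perm.mul_apply, this]
    exact (hL m hm).map_w
  have hinj : Set.InjOn F M := by
    intro m hm m' hm' h
    exact h2 m hm m' hm' (by rw [← hFy m hm, ← hFy m' hm', h])
  have hcard : (F '' M).ncard = M.card := by
    rw [hinj.ncard_image, Set.ncard_coe_finset]
  rw [← hcard]
  refine ncard_le_chi ⟨m₀, hm₀, mul_inv_cancel _⟩ ?_ ?_
  · rintro _ ⟨m, hm, rfl⟩
    apply mem_activePermsCard_of_adj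
    intro a ha b hb
    have hw : ∀ u, u ≠ m₀.2 → (L m₀)⁻¹ u ≠ w := by
      intro u hu h'
      rw [Equiv.Perm.inv_eq_iff_eq, (hL m₀ hm₀).map_w] at h'
      exact hu h'
    have k1 := (hL m₀ hm₀).adj_iff hp hq (hw a ha) (hw b hb)
    have k2 := (hL m hm).adj_iff hp hq (hw a ha) (hw b hb)
    rw [← Equiv.Perm.mul_apply, ← Equiv.Perm.mul_apply, mul_inv_cancel] at k1
    exact k1.symm.trans k2
  · rintro _ ⟨m, hm, rfl⟩ _ ⟨m', hm', rfl⟩ hne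
    rw [hFv m hm, hFv m' hm', hFy m hm, hFy m' hm']
    refine ⟨fun h => hne ?_, fun h => hne ?_⟩
    · rw [h1 m hm m' hm' ((L m₀).injective h)]
    · rw [h2 m hm m' hm' h]

theorem IsGluingAlong.isSupercardAt {A B : Type u} {U : SimpleGraph A} {T : SimpleGraph B}
    (hs : IsSupercardAt U T G v w) {x y : V} {lam : Equiv.Perm V} (hp : p ≠ v) (hq : q ≠ v)
    (h : IsGluingAlong G v w p q x y lam) : IsSupercardAt U T (rejoin G v p q) v y := by
  obtain ⟨⟨eU⟩, ⟨eT⟩⟩ := hs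
  constructor
  · obtain ⟨f⟩ := nonempty_card_iso (G := G) (H := rejoin G v p q) (w := w) (lam := lam)
      fun a ha b hb => h.adj_iff hp hq ha hb
    rw [h.map_w] at f
    exact ⟨eU.comp f.symm⟩
  · obtain ⟨f⟩ := nonempty_card_iso (G := G) (H := rejoin G v p q) (w := v) (lam := 1)
      fun a ha b hb => (rejoin_adj_of_ne ha hb).symm
    exact ⟨eT.comp f.symm⟩

end Rejoin

/-! ### The two ends of the spine of G - v -/

section Ends
variable {V : Type u} {G : SimpleGraph V} {c : ℕ} {e : ZMod c → V} {v w : V} {z : ZMod c}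

/-- `e al` is the first spine vertex of `G - v`, and `l` is a leaf of `G - v` attached to it. -/
structure IsEnd (G : SimpleGraph V) (e : ZMod c → V) (v : V) (al : ℕ) (l : V) : Prop where
  cases : (al = 1 ∧ l ∉ Set.range e) ∨ (al = 2 ∧ (∀ u, G.Adj (e 1) u → u ∈ Set.range e) ∧ l = e 1)
  ne_v : l ≠ v
  adj : ∀ u, u ≠ v → (G.Adj l u ↔ u = e (al : ℕ))

theorem IsEnd.pos {al : ℕ} {l : V} (h : IsEnd G e v al l) : 1 ≤ al := by
  rcases h.cases with h | h <;> omega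

theorem IsEnd.le_two {al : ℕ} {l : V} (h : IsEnd G e v al l) : al ≤ 2 := by
  rcases h.cases with h | h <;> omega

theorem IsFrame.natCast_eq_iff (h : IsFrame G e) {i j : ℕ} (hi : i < c) (hj : j < c) :
    e (i : ℕ) = e (j : ℕ) ↔ i = j :=
  ⟨fun h' => zmod_natCast_inj hi hj (h.inj h'), fun h' => by rw [h']⟩

theorem IsFrame.natCast_adj (h : IsFrame G e) {i j : ℕ} (hi : i < c) (hj : j < c)
    (hadj : G.Adj (e (i : ℕ)) (e (j : ℕ))) :
    j = i + 1 ∨ i = j + 1 ∨ (i = 0 ∧ j + 1 = c) ∨ (j = 0 ∧ i + 1 = c) := by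
  have key : ∀ {i j : ℕ}, i < c → j < c → (j : ZMod c) = (i : ZMod c) + 1 →
      j = i + 1 ∨ (j = 0 ∧ i + 1 = c) := by
    intro i j hi hj h'
    have h1 : (j : ZMod c) = ((i + 1 : ℕ) : ZMod c) := by push_cast; exact h'
    rw [ZMod.natCast_eq_natCast_iff', Nat.mod_eq_of_lt hj] at h1
    rcases Nat.lt_or_ge (i + 1) c with h2 | h2
    · rw [Nat.mod_eq_of_lt h2] at h1
      exact Or.inl h1
    · have h3 : i + 1 = c := by omega
      rw [h3, Nat.mod_self] at h1
      exact Or.inr ⟨h1, h3⟩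
  rcases (h.adj _ _).1 hadj with h1 | h1
  · rcases key hi hj h1 with h2 | h2 <;> tauto
  · rcases key hj hi h1 with h2 | h2 <;> tauto

theorem IsFrame.natCast_adj_succ (h : IsFrame G e) (i : ℕ) :
    G.Adj (e (i : ℕ)) (e ((i + 1 : ℕ) : ZMod c)) := by
  push_cast
  exact h.adj_succ _

theorem IsPointed.natCast_ne_v (h : IsPointed G e v w z) {i : ℕ} (h0 : 0 < i) (hi : i < c) :
    e (i : ℕ) ≠ v := by
  rw [← h.base]
  exact fun h' => zmod_natCast_ne_zero h0 hi (h.inj h')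

theorem IsPointed.exists_natCast (h : IsPointed G e v w z) {u : V} (hu : u ∈ Set.range e)
    (huv : u ≠ v) : ∃ i : ℕ, 1 ≤ i ∧ i < c ∧ e (i : ℕ) = u := by
  have : NeZero c := ⟨by have := h.three_le; omega⟩
  obtain ⟨i, rfl⟩ := hu
  refine ⟨i.val, ?_, ZMod.val_lt i, by rw [ZMod.natCast_zmod_val]⟩
  rw [Nat.one_le_iff_ne_zero, ne_eq, ZMod.val_eq_zero]
  rintro rfl
  exact huv h.base

/-- If e 1 carries a pendant, it stays on the spine of G - v. Otherwise it has lost v, becomes a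
leaf, and the spine starts at e 2. -/
theorem IsPointed.exists_isEnd (h : IsPointed G e v w z) : ∃ al l, IsEnd G e v al l := by
  have hc := h.three_le
  by_cases hp : ∃ u, u ∉ Set.range e ∧ G.Adj (e 1) u
  · obtain ⟨u, hu, hadj⟩ := hp
    obtain ⟨i, hi⟩ := h.pend u hu
    have h1 := (hi _).1 hadj.symm
    refine ⟨1, u, Or.inl ⟨rfl, hu⟩, fun h' => hu ⟨0, h.base.trans h'.symm⟩, fun u' _ => ?_⟩
    rw [hi, ← h1, Nat.cast_one]
  · push Not at hp
    refine ⟨2, e 1, Or.inr ⟨rfl, fun u hu => by_contra fun h' => hp u h' hu, rfl⟩, ?_, ?_⟩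
    · have := h.natCast_ne_v (i := 1) (by omega) (by omega)
      simpa using this
    · intro u huv
      constructor
      · intro hu
        have hur : u ∈ Set.range e := by_contra fun h' => hp u h' hu
        obtain ⟨i, h1, h2, rfl⟩ := h.exists_natCast hur huv
        have := h.natCast_adj (i := 1) (by omega) h2 (by simpa using hu)
        have : i = 2 := by omega
        rw [this]
      · rintro rfl
        simpa using h.natCast_adj_succ 1

theorem IsEnd.left_neighbour (h : IsPointed G e v w z) {al : ℕ} {l : V} (hl : IsEnd G e v al l)
    {i : ℕ} (hi : al ≤ i) (hic : i < c) : ∃ a, G.Adj (e (i : ℕ)) a ∧ a ≠ v ∧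
      ((a = l ∧ i = al) ∨ (a = e ((i - 1 : ℕ) : ZMod c) ∧ 1 ≤ i - 1)) := by
  have h1 := hl.pos
  rcases Nat.eq_or_lt_of_le hi with rfl | hlt
  · exact ⟨l, ((hl.adj _ (h.natCast_ne_v (by omega) hic)).2 rfl).symm, hl.ne_v, Or.inl ⟨rfl, rfl⟩⟩
  · refine ⟨e ((i - 1 : ℕ) : ZMod c), ?_, h.natCast_ne_v (by omega) (by omega),
      Or.inr ⟨rfl, by omega⟩⟩
    have := h.natCast_adj_succ (i - 1)
    rw [show i - 1 + 1 = i by omega] at this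
    exact this.symm

/-- Statements about the right end are those about the left end for the frame i ↦ e (-i), where
position i becomes c - i. -/
theorem neg_natCast_sub {c i : ℕ} (hi : i ≤ c) : -((c - i : ℕ) : ZMod c) = (i : ZMod c) := by
  rw [Nat.cast_sub hi, ZMod.natCast_self]
  ring

theorem IsEnd.right_neighbour (h : IsPointed G e v w z) {al : ℕ} {l : V}
    (hl : IsEnd G (fun i => e (-i)) v al l) {i : ℕ} (hi : i + al ≤ c) (h0 : 0 < i) :
    ∃ a, G.Adj (e (i : ℕ)) a ∧ a ≠ v ∧
      ((a = l ∧ i + al = c) ∨ (a = e ((i + 1 : ℕ) : ZMod c) ∧ i + 1 < c)) := by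
  have h1 := hl.pos
  obtain ⟨a, h2, h3, h4⟩ := hl.left_neighbour h.neg (i := c - i) (by omega) (by omega)
  simp only [neg_natCast_sub (show i ≤ c by omega)] at h2
  refine ⟨a, h2, h3, ?_⟩
  rcases h4 with ⟨h4, h5⟩ | ⟨h4, h5⟩
  · exact Or.inl ⟨h4, by omega⟩
  · right
    rw [show c - i - 1 = c - (i + 1) by omega, neg_natCast_sub (by omega)] at h4
    exact ⟨h4, by omega⟩

/-- A leaf at the left end is not a cycle vertex far from it. -/
theorem IsEnd.ne_natCast (h : IsPointed G e v w z) {al : ℕ} {l : V} (hl : IsEnd G e v al l)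
    {i : ℕ} (hi : 2 ≤ i) (hic : i < c) : l ≠ e (i : ℕ) := by
  rintro rfl
  rcases hl.cases with ⟨-, h1⟩ | ⟨-, -, h1⟩
  · exact h1 ⟨_, rfl⟩
  · have : e (i : ℕ) = e (1 : ℕ) := by simpa using h1
    rw [h.natCast_eq_iff hic (by omega)] at this
    omega

theorem IsEnd.ne_natCast_right (h : IsPointed G e v w z) {al : ℕ} {l : V}
    (hl : IsEnd G (fun i => e (-i)) v al l) {i : ℕ} (h0 : 0 < i) (hic : i + 2 ≤ c) :
    l ≠ e (i : ℕ) := by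
  have := hl.ne_natCast h.neg (i := c - i) (by omega) (by omega)
  simpa only [neg_natCast_sub (show i ≤ c by omega)] using this

variable {al al' : ℕ} {l l' : V}

theorem IsEnd.le_of_pair_adj (hl : IsEnd G e v al l)
    {i : ℕ} (h0 : 1 ≤ i) {a b : V} (hab : a ≠ b) (hav : a ≠ v) (hbv : b ≠ v)
    (ha : G.Adj (e (i : ℕ)) a) (hb : G.Adj (e (i : ℕ)) b) : al ≤ i := by
  by_contra! hlt
  rcases hl.cases with ⟨h1, -⟩ | ⟨h1, -, h2⟩
  · omega
  · have hi : i = 1 := by omega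
    rw [hi, Nat.cast_one, ← h2] at ha hb
    exact hab (((hl.adj _ hav).1 ha).trans ((hl.adj _ hbv).1 hb).symm)

/-- A vertex with two neighbours in `G - v` is on the spine of `G - v`. -/
theorem IsPointed.exists_spine_of_pair_adj (h : IsPointed G e v w z) (hl : IsEnd G e v al l)
    (hr : IsEnd G (fun i => e (-i)) v al' l') {u a b : V} (hu : u ≠ v) (hab : a ≠ b)
    (hav : a ≠ v) (hbv : b ≠ v) (ha : G.Adj u a) (hb : G.Adj u b) :
    ∃ i : ℕ, al ≤ i ∧ i + al' ≤ c ∧ e (i : ℕ) = u := by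
  obtain ⟨i, h1, h2, rfl⟩ := h.exists_natCast (h.mem_range_of_pair_adj hab ha hb) hu
  refine ⟨i, hl.le_of_pair_adj h1 hab hav hbv ha hb, ?_, rfl⟩
  have := hr.le_of_pair_adj (i := c - i) (by omega) hab hav hbv
    (by simpa only [neg_natCast_sub h2.le] using ha)
    (by simpa only [neg_natCast_sub h2.le] using hb)
  omega

/-- Spine vertices keep two neighbours when a leaf other than `l`, `l'` is deleted. -/
theorem IsPointed.exists_pair_adj_of_spine (h : IsPointed G e v w z) (hc : 14 ≤ c)
    (hl : IsEnd G e v al l) (hr : IsEnd G (fun i => e (-i)) v al' l') {i : ℕ} (hi : al ≤ i)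
    (hi' : i + al' ≤ c) {y : V} (hyl : y ≠ l) (hyr : y ≠ l') (hy : y ∉ Set.range e) :
    ∃ a b, a ≠ b ∧ a ≠ v ∧ b ≠ v ∧ a ≠ y ∧ b ≠ y ∧ G.Adj (e (i : ℕ)) a ∧ G.Adj (e (i : ℕ)) b := by
  have p1 := hl.pos
  have p2 := hr.pos
  have q1 := hl.le_two
  have q2 := hr.le_two
  obtain ⟨a, ha, hav, ha'⟩ := hl.left_neighbour h hi (by omega)
  obtain ⟨b, hb, hbv, hb'⟩ := hr.right_neighbour h hi' (by omega)
  have hey : ∀ j, e j ≠ y := fun j hj => hy ⟨j, hj⟩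
  have hay : a ≠ y := by
    rcases ha' with ⟨rfl, -⟩ | ⟨rfl, -⟩
    · exact hyl.symm
    · exact hey _
  have hby : b ≠ y := by
    rcases hb' with ⟨rfl, -⟩ | ⟨rfl, -⟩
    · exact hyr.symm
    · exact hey _
  refine ⟨a, b, ?_, hav, hbv, hay, hby, ha, hb⟩
  rcases ha' with ⟨rfl, h1⟩ | ⟨rfl, h1⟩
  · rcases hb' with ⟨rfl, h2⟩ | ⟨rfl, h2⟩
    · omega
    · exact hl.ne_natCast h (by omega) h2
  · rcases hb' with ⟨rfl, h2⟩ | ⟨rfl, h2⟩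
    · exact (hr.ne_natCast_right h (by omega) (by omega)).symm
    · rw [ne_eq, h.natCast_eq_iff (by omega) h2]
      omega

theorem IsPointed.exists_adj_ne_v (h : IsPointed G e v w z) {y : V} (hy : y ≠ v) :
    ∃ u, u ≠ v ∧ G.Adj y u := by
  by_cases hyr : y ∈ Set.range e
  · obtain ⟨i, rfl⟩ := hyr
    by_cases h1 : e (i + 1) = v
    · exact ⟨e (i - 1), fun h2 => h.succ_ne_pred i (h1.trans h2.symm), h.adj_pred i⟩
    · exact ⟨e (i + 1), h1, h.adj_succ i⟩
  · obtain ⟨i, hi⟩ := h.pend y hyr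
    refine ⟨e i, fun h' => ?_, (hi _).2 rfl⟩
    have h1 : G.Adj v y := by rw [← h']; exact ((hi _).2 rfl).symm
    rcases (h.adj_v _).1 h1 with h2 | h2
    · exact hyr ⟨_, h2.symm⟩
    · exact hyr ⟨_, h2.symm⟩

variable [Fintype V]

open Classical in
theorem mem_degAway_filter {p x u : V} :
    u ∈ (Finset.univ.erase p).filter (G.Adj x) ↔ u ≠ p ∧ G.Adj x u := by simp

theorem IsPointed.degAway_pos (h : IsPointed G e v w z) {y : V} (hy : y ≠ v) :
    1 ≤ degAway G v y := by
  classical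
  obtain ⟨u, huv, hu⟩ := h.exists_adj_ne_v hy
  unfold degAway
  exact Finset.card_pos.2 ⟨u, mem_degAway_filter.2 ⟨huv, hu⟩⟩

theorem exists_pair_of_two_le_degAway {p x : V} (h : 2 ≤ degAway G p x) :
    ∃ a b, a ≠ b ∧ a ≠ p ∧ b ≠ p ∧ G.Adj x a ∧ G.Adj x b := by
  classical
  unfold degAway at h
  obtain ⟨a, ha, b, hb, hab⟩ := Finset.one_lt_card.1 (show 1 < _ from h)
  rw [mem_degAway_filter] at ha hb
  exact ⟨a, b, hab, ha.1, hb.1, ha.2, hb.2⟩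

/-- Counting edges on both sides of a gluing. -/
theorem IsPointed.degAway_eq (h : IsPointed G e v w z) {x y : V} {lam : Equiv.Perm V}
    (hg : IsGluing G v w x y lam) : degAway G w x = degAway G v y + 1 := by
  classical
  -- Deleting v removes two edges and deleting w removes one; this difference is the +1 in the
  -- conclusion.
  have hdv : deg G v = 2 := by
    have h1 : pendants G e 0 = ∅ := by
      rw [Finset.eq_empty_iff_forall_notMem]
      intro u hu
      rw [mem_pendants, h.base, h.adj_v] at hu
      rcases hu with ⟨h1, rfl | rfl⟩ <;> exact h1 ⟨_, rfl⟩
    rw [← h.base, h.toIsFrame.deg_eq, h1, Finset.card_empty]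
  have hdw : deg G w = 1 := deg_eq_one h.adj_w
  have h1 := adjPairs_univ_eq (G := G) w
  have h2 := adjPairs_univ_eq (G := G) v
  have h3 := adjPairs_erase G (S := Finset.univ.erase w) (x := x) (by simpa using hg.ne_w)
  have h4 := adjPairs_erase G (S := Finset.univ.erase v) (x := y) (by simpa using hg.ne_v)
  have h5 : adjPairs G ((Finset.univ.erase w).erase x) =
      adjPairs G ((Finset.univ.erase v).erase y) := by
    refine adjPairs_eq_of_map G lam ?_ ?_
    · intro a
      simp only [Finset.mem_erase, Finset.mem_univ, and_true, ← hg.map_x, ← hg.map_w, ne_eq,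
        EmbeddingLike.apply_eq_iff_eq]
      tauto
    · intro a ha b hb
      simp only [Finset.mem_erase, Finset.mem_univ, and_true] at ha hb
      exact hg.adj a b ha.2 ha.1 hb.2 hb.1
  have h6 : ((Finset.univ.erase w).filter (G.Adj x)).card = degAway G w x := by
    unfold degAway; congr!
  have h7 : ((Finset.univ.erase v).filter (G.Adj y)).card = degAway G v y := by
    unfold degAway; congr!
  omega

theorem IsPointed.mem_range_of_isGluing (h : IsPointed G e v w z) {x y : V} {lam : Equiv.Perm V}
    (hg : IsGluing G v w x y lam) : x ∈ Set.range e := by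
  have h1 := h.degAway_eq hg
  have h2 := h.degAway_pos hg.ne_v
  obtain ⟨a, b, hab, -, -, ha, hb⟩ := exists_pair_of_two_le_degAway (show 2 ≤ degAway G w x by omega)
  exact h.mem_range_of_pair_adj hab ha hb

/-- Apart from the two ends of the spine, only leaves of `G - v` are glued to. -/
theorem IsPointed.degAway_eq_one (h : IsPointed G e v w z)
    (hl : IsEnd G e v al l) (hr : IsEnd G (fun i => e (-i)) v al' l') {x y : V}
    {lam : Equiv.Perm V} (hg : IsGluing G v w x y lam) (hy1 : y ≠ e (al : ℕ))
    (hy2 : y ≠ e (-(al' : ZMod c))) : degAway G v y = 1 := by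
  classical
  have p1 := hl.pos
  have p2 := hr.pos
  have h1 := h.degAway_eq hg
  have h2 := h.degAway_pos hg.ne_v
  by_contra hne
  obtain ⟨a, b, hab, hav, hbv, ha, hb⟩ :=
    exists_pair_of_two_le_degAway (show 2 ≤ degAway G v y by omega)
  obtain ⟨i, hi, hi', rfl⟩ := h.exists_spine_of_pair_adj hl hr hg.ne_v hab hav hbv ha hb
  have hi1 : al < i := lt_of_le_of_ne hi fun h' => hy1 (by rw [h'])
  have hi2 : i + al' < c := lt_of_le_of_ne hi' fun h' => hy2 (by
    rw [← neg_natCast_sub (show i ≤ c by omega), show c - i = al' by omega])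
  obtain ⟨j, rfl⟩ := h.mem_range_of_isGluing hg
  -- These are the vertices isolated once p and q are deleted. Deleting x from G - w isolates at
  -- least deg x - 2 of them, deleting an inner spine vertex y from G - v at most deg y - 2, which
  -- is incompatible with deg x = deg y + 1.
  let I : V → V → Finset V := fun p q =>
    Finset.univ.filter fun a => a ≠ p ∧ a ≠ q ∧ ∀ u, G.Adj a u → u = p ∨ u = q
  have hI : (I w (e j)).card ≤ (I v (e (i : ℕ))).card := by
    refine Finset.card_le_card_of_injOn lam (fun a ha => ?_) lam.injective.injOn
    simp only [I, Finset.coe_filter, Finset.mem_univ, true_and, Set.mem_ofPred_eq] at ha ⊢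
    obtain ⟨haw, hax, hadj⟩ := ha
    refine ⟨fun h' => hax (lam.injective (h'.trans hg.map_x.symm)),
      fun h' => haw (lam.injective (h'.trans hg.map_w.symm)), fun u hu => ?_⟩
    by_contra! hcon
    obtain ⟨u, rfl⟩ := lam.surjective u
    have huw : u ≠ w := by rintro rfl; exact hcon.2 hg.map_w
    have hux : u ≠ e j := by rintro rfl; exact hcon.1 hg.map_x
    rcases hadj u ((hg.adj a u haw hax huw hux).2 hu) with h' | h'
    · exact huw h'
    · exact hux h'
  have hlow : degAway G w (e j) - 2 ≤ (I w (e j)).card := by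
    have hsub : ((Finset.univ.erase w).filter (G.Adj (e j))) \ {e (j + 1), e (j - 1)} ⊆
        I w (e j) := by
      intro u hu
      simp only [Finset.mem_sdiff, mem_degAway_filter, Finset.mem_insert, Finset.mem_singleton,
        not_or] at hu
      obtain ⟨⟨huw, hadj⟩, hu1, hu2⟩ := hu
      have hur : u ∉ Set.range e := by
        rintro ⟨k, rfl⟩
        rcases (h.adj _ _).1 hadj with rfl | rfl
        · exact hu1 rfl
        · exact hu2 (by congr 1; ring)
      obtain ⟨k, hk⟩ := h.pend u hur
      have hkj := (hk _).1 hadj.symm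
      simp only [I, Finset.mem_filter, Finset.mem_univ, true_and]
      exact ⟨huw, hadj.ne', fun u' hu' => Or.inr (((hk _).1 hu').trans hkj.symm)⟩
    have h3 := Finset.card_le_card hsub
    have h4 := Finset.le_card_sdiff {e (j + 1), e (j - 1)}
      ((Finset.univ.erase w).filter (G.Adj (e j)))
    have h5 : ({e (j + 1), e (j - 1)} : Finset V).card ≤ 2 := Finset.card_le_two
    unfold degAway
    omega
  have hup : (I v (e (i : ℕ))).card + 2 ≤ degAway G v (e (i : ℕ)) := by
    have hs := h.natCast_adj_succ i
    have hp := h.natCast_adj_succ (i - 1)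
    rw [show i - 1 + 1 = i by omega] at hp
    have hsub : I v (e (i : ℕ)) ⊆ ((Finset.univ.erase v).filter (G.Adj (e (i : ℕ)))) \
        {e ((i + 1 : ℕ) : ZMod c), e ((i - 1 : ℕ) : ZMod c)} := by
      intro u hu
      simp only [I, Finset.mem_filter, Finset.mem_univ, true_and] at hu
      obtain ⟨huv, hui, hadj⟩ := hu
      simp only [Finset.mem_sdiff, mem_degAway_filter, Finset.mem_insert, Finset.mem_singleton,
        not_or]
      obtain ⟨u', hu'v, hu'⟩ := h.exists_adj_ne_v huv
      have hu'' := (hadj u' hu').resolve_left hu'v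
      subst hu''
      refine ⟨⟨huv, hu'.symm⟩, ?_, ?_⟩
      · rintro rfl
        obtain ⟨b, hb, hbv, hb'⟩ := hr.right_neighbour h (i := i + 1) (by omega) (by omega)
        have hbi := (hadj b hb).resolve_left hbv
        rcases hb' with ⟨rfl, h3⟩ | ⟨rfl, h3⟩
        · exact hr.ne_natCast_right h (i := i) (by omega) (by omega) hbi
        · rw [h.natCast_eq_iff h3 (by omega)] at hbi
          omega
      · rintro rfl
        obtain ⟨b, hb, hbv, hb'⟩ := hl.left_neighbour h (i := i - 1) (by omega) (by omega)
        have hbi := (hadj b hb).resolve_left hbv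
        rcases hb' with ⟨rfl, h3⟩ | ⟨rfl, h3⟩
        · exact hl.ne_natCast h (i := i) (by omega) (by omega) hbi
        · rw [h.natCast_eq_iff (by omega) (by omega)] at hbi
          omega
    have h3 := Finset.card_le_card hsub
    rw [Finset.card_sdiff_of_subset, Finset.card_pair] at h3
    · have h4 : degAway G v (e (i : ℕ)) =
          ((Finset.univ.erase v).filter (G.Adj (e (i : ℕ)))).card := rfl
      omega
    · rw [ne_eq, h.natCast_eq_iff (by omega) (by omega)]
      omega
    · intro u hu
      simp only [Finset.mem_insert, Finset.mem_singleton] at hu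
      rw [mem_degAway_filter]
      rcases hu with rfl | rfl
      · exact ⟨h.natCast_ne_v (by omega) (by omega), hs⟩
      · exact ⟨h.natCast_ne_v (by omega) (by omega), hp.symm⟩
  omega

end Ends

/-! ### Paths covering the spine -/

section Track
variable {V : Type u} {G : SimpleGraph V} {c : ℕ} {e : ZMod c → V} {v w : V} {z : ZMod c}
  {al al' : ℕ} {l l' : V}

/-- A path on `c - 1` vertices of `G - v` covering the spine of `G - v`. -/
structure IsTrack (G : SimpleGraph V) (e : ZMod c → V) (v : V) (al al' : ℕ) (q : ℕ → V) :
    Prop where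
  ne_v : ∀ k, 1 ≤ k → k < c → q k ≠ v
  adj : ∀ k, 1 ≤ k → k + 1 < c → G.Adj (q k) (q (k + 1))
  inj : ∀ k k', 1 ≤ k → k < c → 1 ≤ k' → k' < c → q k = q k' → k = k'
  cover : ∀ i, al ≤ i → i + al' ≤ c → ∃ k, 1 ≤ k ∧ k < c ∧ q k = e (i : ℕ)

/-- The inner vertices of the path are consecutive spine vertices, starting from `e s`. -/
structure IsIncreasing (e : ZMod c → V) (al al' : ℕ) (q : ℕ → V) (s : ℕ) : Prop where
  eq : ∀ k, 2 ≤ k → k + 2 ≤ c → q k = e ((s + (k - 2) : ℕ) : ZMod c)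
  lo : al ≤ s
  hi : s + (c - 4) + al' ≤ c

theorem IsTrack.reverse {q : ℕ → V} (h : IsTrack G e v al al' q) :
    IsTrack G e v al al' fun k => q (c - k) where
  ne_v := fun k h1 h2 => h.ne_v _ (by omega) (by omega)
  adj := fun k h1 h2 => by
    have := h.adj (c - (k + 1)) (by omega) (by omega)
    rw [show c - (k + 1) + 1 = c - k by omega] at this
    exact this.symm
  inj := fun k k' h1 h2 h3 h4 h5 => by
    have := h.inj _ _ (by omega) (by omega) (by omega) (by omega) h5
    omega
  cover := fun i h1 h2 => by
    obtain ⟨k, h3, h4, h5⟩ := h.cover i h1 h2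
    exact ⟨c - k, by omega, by omega, by rw [← h5]; congr 1; omega⟩

theorem IsTrack.mirror {q : ℕ → V} (h : IsTrack G e v al al' q) :
    IsTrack G (fun i => e (-i)) v al' al fun k => q (c - k) where
  ne_v := h.reverse.ne_v
  adj := h.reverse.adj
  inj := h.reverse.inj
  cover := fun i h1 h2 => by
    obtain ⟨k, h3, h4, h5⟩ := h.reverse.cover (c - i) (by omega) (by omega)
    refine ⟨k, h3, h4, ?_⟩
    rw [h5, ← neg_natCast_sub (show c - i ≤ c by omega), show c - (c - i) = i by omega]

/-- The inner part ends at spine position s + (c - 4), which is 4 - s counted from the other side.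
The subtraction does not truncate, because `hi` gives s + al' ≤ 4. -/
theorem IsIncreasing.mirror {q : ℕ → V} {s : ℕ} (hc : 14 ≤ c) (h : IsIncreasing e al al' q s) :
    IsIncreasing (fun i => e (-i)) al' al (fun k => q (c - k)) (4 - s) where
  eq := fun k h1 h2 => by
    have h3 := h.hi
    rw [h.eq _ (by omega) (by omega), ← neg_natCast_sub (show s + (c - k - 2) ≤ c by omega)]
    congr 3
    omega
  lo := by have := h.hi; omega
  hi := by have := h.hi; have := h.lo; omega

/-- Inner vertices of the path have two neighbours in G - v, hence lie on the spine. Their positions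
move by ±1 without turning back, so they run steadily right or left. -/
theorem IsTrack.exists_isIncreasing (hG : IsPointed G e v w z) (hc : 14 ≤ c)
    (hl : IsEnd G e v al l) (hr : IsEnd G (fun i => e (-i)) v al' l') {q : ℕ → V}
    (h : IsTrack G e v al al' q) :
    (∃ s, IsIncreasing e al al' q s) ∨ ∃ s, IsIncreasing e al al' (fun k => q (c - k)) s := by
  have p1 := hl.pos
  have p2 := hr.pos
  have hpos : ∀ t : ℕ, ∃ i : ℕ, t + 4 ≤ c → (al ≤ i ∧ i + al' ≤ c ∧ e (i : ℕ) = q (t + 2)) := by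
    intro t
    by_cases ht : t + 4 ≤ c
    · obtain ⟨i, hi⟩ := hG.exists_spine_of_pair_adj hl hr (h.ne_v (t + 2) (by omega) (by omega))
        (a := q (t + 3)) (b := q (t + 1))
        (fun h' => by have := h.inj _ _ (by omega) (by omega) (by omega) (by omega) h'; omega)
        (h.ne_v _ (by omega) (by omega)) (h.ne_v _ (by omega) (by omega))
        (h.adj (t + 2) (by omega) (by omega)) (h.adj (t + 1) (by omega) (by omega)).symm
      exact ⟨i, fun _ => hi⟩
    · exact ⟨0, fun h' => absurd h' ht⟩
  choose pos hpos using hpos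
  have hstep := arithmetic_of_unit_steps (fun t => (pos t : ℤ)) (c - 4)
    (by
      intro t ht
      obtain ⟨h1, h2, h3⟩ := hpos t (by omega)
      obtain ⟨h4, h5, h6⟩ := hpos (t + 1) (by omega)
      have := h.adj (t + 2) (by omega) (by omega)
      rw [← h3, show t + 2 + 1 = t + 1 + 2 by ring, ← h6] at this
      have := hG.natCast_adj (by omega) (by omega) this
      omega)
    (by
      intro t ht h'
      obtain ⟨h1, h2, h3⟩ := hpos t (by omega)
      obtain ⟨h4, h5, h6⟩ := hpos (t + 2) (by omega)
      have h'' : pos (t + 2) = pos t := by exact_mod_cast h'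
      rw [h'', h3] at h6
      have := h.inj _ _ (by omega) (by omega) (by omega) (by omega) h6
      omega)
  have h0 := hpos 0 (by omega)
  have hlast := hpos (c - 4) (by omega)
  rcases hstep with h1 | h1
  · left
    have hN := h1 (c - 4) le_rfl
    refine ⟨pos 0, fun k hk1 hk2 => ?_, h0.1, by omega⟩
    have hk := hpos (k - 2) (by omega)
    have := h1 (k - 2) (by omega)
    rw [show k - 2 + 2 = k by omega] at hk
    rw [← hk.2.2]
    congr 2
    omega
  · right
    have hN := h1 (c - 4) le_rfl
    refine ⟨pos (c - 4), fun k hk1 hk2 => ?_, hlast.1, by omega⟩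
    have hk := hpos (c - k - 2) (by omega)
    have := h1 (c - k - 2) (by omega)
    rw [show c - k - 2 + 2 = c - k by omega] at hk
    rw [← hk.2.2]
    congr 2
    omega

/-- `u` is the first spine vertex of `G - v` or a leaf of `G - v` attached to it. -/
def IsEndVertex (G : SimpleGraph V) (e : ZMod c → V) (v : V) (al : ℕ) (u : V) : Prop :=
  u = e (al : ℕ) ∨ ∀ u', u' ≠ v → (G.Adj u u' ↔ u' = e (al : ℕ))

/-- Where the path starts. -/
theorem IsTrack.start (hG : IsPointed G e v w z) (hc : 14 ≤ c) (hl : IsEnd G e v al l)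
    (hr : IsEnd G (fun i => e (-i)) v al' l')
    {q : ℕ → V} {s : ℕ} (h : IsTrack G e v al al' q) (hs : IsIncreasing e al al' q s) :
    (s = al ∧ ∀ u, u ≠ v → (G.Adj (q 1) u ↔ u = e (al : ℕ))) ∨ (s = al + 1 ∧ q 1 = e (al : ℕ)) := by
  have p1 := hl.pos
  have p2 := hr.pos
  have p3 := hl.le_two
  have hlo := hs.lo
  have hhi := hs.hi
  -- A spine vertex before e s must still be covered; it is too far from the last inner vertex to be
  -- q (c - 1), so it is q 1. Hence s exceeds al by at most one.
  have hfirst : ∀ i, al ≤ i → i < s → q 1 = e (i : ℕ) := by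
    intro i h1 h2
    obtain ⟨k, hk1, hk2, hk⟩ := h.cover i h1 (by omega)
    rcases Nat.eq_or_lt_of_le hk1 with rfl | hk1
    · exact hk
    · exfalso
      by_cases hk3 : k + 2 ≤ c
      · rw [hs.eq k (by omega) hk3, hG.natCast_eq_iff (by omega) (by omega)] at hk
        omega
      · have hadj := h.adj (k - 1) (by omega) (by omega)
        rw [show k - 1 + 1 = k by omega, hk, hs.eq (k - 1) (by omega) (by omega)] at hadj
        have := hG.natCast_adj (by omega) (by omega) hadj
        omega
  have h2 : q 2 = e (s : ℕ) := by simpa using hs.eq 2 le_rfl (by omega)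
  have h3 : q 3 = e ((s + 1 : ℕ) : ZMod c) := by simpa using hs.eq 3 (by omega) (by omega)
  rcases Nat.eq_or_lt_of_le hlo with rfl | hlt
  · left
    refine ⟨rfl, ?_⟩
    have hadj : G.Adj (q 1) (e (al : ℕ)) := by
      have := h.adj 1 le_rfl (by omega)
      rwa [show 1 + 1 = 2 by rfl, h2] at this
    by_cases hq : q 1 ∈ Set.range e
    · obtain ⟨i, hi1, hi2, hi⟩ := hG.exists_natCast hq (h.ne_v 1 le_rfl (by omega))
      rw [← hi] at hadj
      have h4 := hG.natCast_adj hi2 (by omega) hadj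
      have h5 : i ≠ al + 1 := by
        rintro rfl
        rw [← h3] at hi
        have := h.inj _ _ (by omega) (by omega) (by omega) (by omega) hi
        omega
      rcases hl.cases with ⟨h6, -⟩ | ⟨h6, -, h7⟩
      · omega
      · have h8 : i = 1 := by omega
        rw [h8, Nat.cast_one] at hi
        rw [← hi, ← h7]
        exact hl.adj
    · obtain ⟨i, hi⟩ := hG.pend _ hq
      have h4 := (hi _).1 hadj
      intro u _
      rw [hi, h4]
  · right
    have h4 := hfirst al le_rfl hlt
    refine ⟨?_, h4⟩
    by_contra hne
    have h5 := hfirst (al + 1) (by omega) (by omega)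
    rw [h4, hG.natCast_eq_iff (by omega) (by omega)] at h5
    omega

theorem IsEnd.isEndVertex (hl : IsEnd G e v al l) : IsEndVertex G e v al l := Or.inr hl.adj

/-- Vertices at different ends are different. -/
theorem IsEndVertex.ne (hG : IsPointed G e v w z) (hc : 14 ≤ c) (hl : IsEnd G e v al l)
    (hr : IsEnd G (fun i => e (-i)) v al' l') {u u' : V} (hu : IsEndVertex G e v al u)
    (hu' : IsEndVertex G (fun i => e (-i)) v al' u') : u ≠ u' := by
  rintro rfl
  have p1 := hl.pos
  have p2 := hr.pos
  have p3 := hl.le_two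
  have p4 := hr.le_two
  have hcast : e (-(al' : ZMod c)) = e ((c - al' : ℕ) : ZMod c) := by
    rw [← neg_natCast_sub (show c - al' ≤ c by omega), show c - (c - al') = al' by omega]
  have hne : e (al : ℕ) ≠ e (-(al' : ZMod c)) := by
    rw [hcast, ne_eq, hG.natCast_eq_iff (by omega) (by omega)]
    omega
  have hv : e (al : ℕ) ≠ v := hG.natCast_ne_v (by omega) (by omega)
  have hv' : e (-(al' : ZMod c)) ≠ v := by
    rw [hcast]
    exact hG.natCast_ne_v (by omega) (by omega)
  rcases hu with rfl | hu <;> rcases hu' with hu' | hu'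
  · exact hne hu'
  · have h1 := hG.natCast_adj_succ al
    have h2 := (hu' _ (hG.natCast_ne_v (by omega) (by omega))).1 h1
    simp only [hcast] at h2
    rw [hG.natCast_eq_iff (by omega) (by omega)] at h2
    omega
  · simp only at hu'
    rw [hu', hcast] at hu
    have h1 := hG.natCast_adj_succ (c - al' - 1)
    rw [show c - al' - 1 + 1 = c - al' by omega] at h1
    have h2 := (hu _ (hG.natCast_ne_v (by omega) (by omega))).1 h1.symm
    rw [hG.natCast_eq_iff (by omega) (by omega)] at h2
    omega
  · exact hne (((hu' _ hv).1 ((hu _ hv).2 rfl)))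

/-- Leaves of `G - v` with the same neighbour can be exchanged in a gluing. -/
theorem IsGluing.swap [DecidableEq V] {x y a b t : V} {lam : Equiv.Perm V}
    (h : IsGluing G v w x y lam) (hav : a ≠ v) (hbv : b ≠ v) (hay : a ≠ y) (hby : b ≠ y)
    (ha : ∀ u, u ≠ v → (G.Adj a u ↔ u = t)) (hb : ∀ u, u ≠ v → (G.Adj b u ↔ u = t)) :
    IsGluing G v w x y (lam.trans (Equiv.swap a b)) := by
  have hta : t ≠ a := fun h' => G.irrefl ((ha a hav).2 h'.symm)
  have htb : t ≠ b := fun h' => G.irrefl ((hb b hbv).2 h'.symm)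
  have hne : ∀ u, u ≠ v → Equiv.swap a b u ≠ v := by
    intro u hu h'
    rw [Equiv.swap_apply_eq_iff, Equiv.swap_apply_of_ne_of_ne hav.symm hbv.symm] at h'
    exact hu h'
  have key : ∀ d, d ≠ v → (∀ u, u ≠ v → (G.Adj d u ↔ u = t)) → ∀ u, u ≠ v →
      (G.Adj d u ↔ Equiv.swap a b u = t) := by
    intro d hd hadj u hu
    rw [hadj u hu, Equiv.swap_apply_eq_iff, Equiv.swap_apply_of_ne_of_ne hta htb]
  have hsw : ∀ u u', u ≠ v → u' ≠ v →
      (G.Adj u u' ↔ G.Adj (Equiv.swap a b u) (Equiv.swap a b u')) := by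
    intro u u' hu hu'
    by_cases h1 : u = a
    · rw [h1, Equiv.swap_apply_left, hb _ (hne _ hu'), key a hav ha u' hu']
    · by_cases h2 : u = b
      · rw [h2, Equiv.swap_apply_right, ha _ (hne _ hu'), key b hbv hb u' hu']
      · rw [Equiv.swap_apply_of_ne_of_ne h1 h2]
        by_cases h3 : u' = a
        · rw [h3, Equiv.swap_apply_left, G.adj_comm, G.adj_comm u b, ha u hu, hb u hu]
        · by_cases h4 : u' = b
          · rw [h4, Equiv.swap_apply_right, G.adj_comm, G.adj_comm u a, ha u hu, hb u hu]
          · rw [Equiv.swap_apply_of_ne_of_ne h3 h4]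
  refine ⟨h.ne_w, h.ne_v, ?_, ?_, ?_⟩
  · rw [Equiv.trans_apply, h.map_x, Equiv.swap_apply_of_ne_of_ne hav.symm hbv.symm]
  · rw [Equiv.trans_apply, h.map_w, Equiv.swap_apply_of_ne_of_ne hay.symm hby.symm]
  · intro c d hcw hcx hdw hdx
    have hv : ∀ u, u ≠ x → lam u ≠ v := fun u hu h' => hu (lam.injective (h'.trans h.map_x.symm))
    rw [h.adj c d hcw hcx hdw hdx]
    exact hsw _ _ (hv c hcx) (hv d hdx)

/-- The end of the path of type `s`. -/
def endVertex (e : ZMod c → V) (al : ℕ) (l : V) (s : ℕ) : V := if s = al then l else e (al : ℕ)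

theorem isEndVertex_endVertex (hl : IsEnd G e v al l) (s : ℕ) :
    IsEndVertex G e v al (endVertex e al l s) := by
  unfold endVertex
  split_ifs
  · exact hl.isEndVertex
  · exact Or.inl rfl

theorem IsPointed.endVertex_ne_v (hG : IsPointed G e v w z) (hl : IsEnd G e v al l) (s : ℕ) :
    endVertex e al l s ≠ v := by
  have := hl.pos
  have := hl.le_two
  have := hG.three_le
  unfold endVertex
  split_ifs
  · exact hl.ne_v
  · exact hG.natCast_ne_v (by omega) (by omega)

/-- A gluing can be changed so that the path starts at the standard end vertex. -/
theorem IsGluing.exists_adjust (hG : IsPointed G e v w z) (hl : IsEnd G e v al l) {x y a : V}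
    {s : ℕ} {lam : Equiv.Perm V} (h : IsGluing G v w x y lam) (hyl : y ≠ l) (hay : a ≠ y)
    (hav : a ≠ v) (hs : (s = al ∧ ∀ u, u ≠ v → (G.Adj a u ↔ u = e (al : ℕ))) ∨
      (s = al + 1 ∧ a = e (al : ℕ))) :
    ∃ lam', IsGluing G v w x y lam' ∧ (∀ u, lam u = a → lam' u = endVertex e al l s) ∧
      ∀ u, lam u ≠ a → lam u ≠ l → lam' u = lam u := by
  classical
  have := hl.pos
  have := hl.le_two
  have := hG.three_le
  rcases hs with ⟨rfl, hs⟩ | ⟨rfl, rfl⟩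
  · refine ⟨lam.trans (Equiv.swap a l), h.swap hav hl.ne_v hay hyl.symm
      hs hl.adj, fun u hu => ?_, fun u h1 h2 => ?_⟩
    · rw [Equiv.trans_apply, hu, Equiv.swap_apply_left, endVertex, if_pos rfl]
    · rw [Equiv.trans_apply, Equiv.swap_apply_of_ne_of_ne h1 h2]
  · refine ⟨lam, h, fun u hu => ?_, fun u _ _ => rfl⟩
    rw [hu, endVertex, if_neg (by omega)]

theorem isEndVertex_of_start {a : V} {s : ℕ}
    (hs : (s = al ∧ ∀ u, u ≠ v → (G.Adj a u ↔ u = e (al : ℕ))) ∨ (s = al + 1 ∧ a = e (al : ℕ))) :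
    IsEndVertex G e v al a := by
  rcases hs with ⟨-, h⟩ | ⟨-, h⟩
  · exact Or.inr h
  · exact Or.inl h

/-- Given a covering path oriented from left to right, a gluing can be adjusted to one of the
standard types. -/
theorem IsGluing.exists_isGluingAlong (hG : IsPointed G e v w z) (hc : 14 ≤ c)
    (hl : IsEnd G e v al l) (hr : IsEnd G (fun i => e (-i)) v al' l') {x y x₁ x₂ : V}
    {lam : Equiv.Perm V} (h : IsGluing G v w x y lam) (hyl : y ≠ l) (hyr : y ≠ l')
    (hx : ∀ b, b ≠ w → (G.Adj x b ↔ b = x₁ ∨ b = x₂)) {q : ℕ → V} {s : ℕ}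
    (hq : IsTrack G e v al al' q) (hs : IsIncreasing e al al' q s)
    (hqy : ∀ k, 1 ≤ k → k < c → q k ≠ y) (hx₁ : lam x₁ = q 1) (hx₂ : lam x₂ = q (c - 1)) :
    (s = al ∨ s = al + 1) ∧ (4 - s = al' ∨ 4 - s = al' + 1) ∧
      ∃ lam', IsGluingAlong G v w (endVertex e al l s)
        (endVertex (fun i => e (-i)) al' l' (4 - s)) x y lam' := by
  have hstart := hq.start hG hc hl hr hs
  have hr' : IsEnd G (fun i => (fun i => e (-i)) (-i)) v al l := by simpa using hl
  have hend := hq.mirror.start hG.neg hc hr hr' (hs.mirror hc)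
  refine ⟨by omega, by omega, ?_⟩
  have hev₁ := isEndVertex_of_start hstart
  have hev₂ := isEndVertex_of_start (e := fun i => e (-i)) hend
  obtain ⟨lam₁, hg₁, h11, h12⟩ := h.exists_adjust hG hl hyl (hqy 1 le_rfl (by omega))
    (hq.ne_v 1 le_rfl (by omega)) hstart
  have hne : ∀ {u u'}, IsEndVertex G e v al u → IsEndVertex G (fun i => e (-i)) v al' u' →
      u ≠ u' := fun hu hu' => hu.ne hG hc hl hr hu'
  have h2 : lam₁ x₂ = q (c - 1) := by
    rw [← hx₂]
    apply h12
    · rw [hx₂]; exact (hne hev₁ hev₂).symm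
    · rw [hx₂]; exact (hne hl.isEndVertex hev₂).symm
  obtain ⟨lam₂, hg₂, h21, h22⟩ := hg₁.exists_adjust hG.neg hr hyr
    (hqy (c - 1) (by omega) (by omega)) (hq.ne_v (c - 1) (by omega) (by omega)) hend
  -- The exchange at the right end leaves the left end in place, as end vertices of opposite sides
  -- are distinct.
  have h3 : lam₂ x₁ = endVertex e al l s := by
    rw [h22, h11 _ hx₁]
    · rw [h11 _ hx₁]; exact hne (isEndVertex_endVertex hl s) hev₂
    · rw [h11 _ hx₁]; exact hne (isEndVertex_endVertex hl s) hr.isEndVertex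
  have h4 := h21 _ h2
  refine ⟨lam₂, hg₂, fun b hb => ?_⟩
  rw [hx b hb, ← h3, ← h4, EmbeddingLike.apply_eq_iff_eq, EmbeddingLike.apply_eq_iff_eq]

end Track

/-! ### Classification of gluings -/

section Classify
variable {V : Type u} [Fintype V] {G : SimpleGraph V} {c : ℕ} {e : ZMod c → V} {v w : V}
  {z : ZMod c} {al al' : ℕ} {l l' : V}

/-- Apart from four exceptional vertices, the vertices glued to are leaves of `G - v` attached to
the spine. -/
theorem IsPointed.leaf_of_isGluing (hG : IsPointed G e v w z)
    (hl : IsEnd G e v al l) (hr : IsEnd G (fun i => e (-i)) v al' l') {x y : V}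
    {lam : Equiv.Perm V} (h : IsGluing G v w x y lam) (hy1 : y ≠ e (al : ℕ))
    (hy2 : y ≠ e (-(al' : ZMod c))) (hyl : y ≠ l) (hyr : y ≠ l') :
    y ∉ Set.range e ∧ ∃ i : ℕ, al ≤ i ∧ i + al' ≤ c ∧
      ∀ u, u ≠ v → (G.Adj y u ↔ u = e (i : ℕ)) := by
  classical
  have p1 := hl.pos
  have p2 := hr.pos
  have hdeg := hG.degAway_eq_one hl hr h hy1 hy2
  have huniq : ∀ a b, a ≠ v → b ≠ v → G.Adj y a → G.Adj y b → a = b := by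
    intro a b hav hbv ha hb
    unfold degAway at hdeg
    exact Finset.card_le_one.1 hdeg.le a (mem_degAway_filter.2 ⟨hav, ha⟩) b
      (mem_degAway_filter.2 ⟨hbv, hb⟩)
  have hyrange : y ∉ Set.range e := by
    intro hy
    obtain ⟨i, hi1, hi2, rfl⟩ := hG.exists_natCast hy h.ne_v
    by_cases h1 : i = 1
    · rcases hl.cases with ⟨h2, -⟩ | ⟨-, -, h2⟩
      · exact hy1 (by rw [h1, h2])
      · exact hyl (by rw [h1, h2, Nat.cast_one])
    · by_cases h2 : i + 1 = c
      · have hcast : (i : ZMod c) = -1 := by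
          rw [eq_neg_iff_add_eq_zero]
          have : ((i + 1 : ℕ) : ZMod c) = 0 := by rw [h2, ZMod.natCast_self]
          simpa using this
        rcases hr.cases with ⟨h3, -⟩ | ⟨-, -, h3⟩
        · exact hy2 (by rw [h3, Nat.cast_one, hcast])
        · exact hyr (by rw [h3, hcast])
      · have hs := hG.natCast_adj_succ i
        have hp := hG.natCast_adj_succ (i - 1)
        rw [show i - 1 + 1 = i by omega] at hp
        have := huniq _ _ (hG.natCast_ne_v (by omega) (by omega))
          (hG.natCast_ne_v (by omega) (by omega)) hs hp.symm
        rw [hG.natCast_eq_iff (by omega) (by omega)] at this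
        omega
  refine ⟨hyrange, ?_⟩
  obtain ⟨j, hj⟩ := hG.pend y hyrange
  have hyj : G.Adj (e j) y := ((hj _).2 rfl).symm
  obtain ⟨u, huv, hu⟩ := hG.exists_adj_ne_v h.ne_v
  have hjv : e j ≠ v := by rw [← (hj u).1 hu]; exact huv
  obtain ⟨i, hi1, hi2, hi⟩ := hG.exists_natCast ⟨j, rfl⟩ hjv
  refine ⟨i, ?_, ?_, fun u _ => by rw [hi, hj]⟩
  · rcases hl.cases with ⟨h1, -⟩ | ⟨h1, h2, -⟩
    · omega
    · by_contra! hlt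
      have h3 : i = 1 := by omega
      rw [h3, Nat.cast_one] at hi
      rw [← hi] at hyj
      exact hyrange (h2 y hyj)
  · rcases hr.cases with ⟨h1, -⟩ | ⟨h1, h2, -⟩
    · omega
    · by_contra! hlt
      have h3 : i + 1 = c := by omega
      have hcast : (i : ZMod c) = -1 := by
        rw [eq_neg_iff_add_eq_zero]
        have : ((i + 1 : ℕ) : ZMod c) = 0 := by rw [h3, ZMod.natCast_self]
        simpa using this
      rw [← hi, hcast] at hyj
      obtain ⟨k, hk⟩ := h2 y hyj
      exact hyrange ⟨-k, hk⟩

/-- The classification of gluings by two possible types. -/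
theorem IsPointed.classify (hG : IsPointed G e v w z) (hc : 14 ≤ c)
    (hl : IsEnd G e v al l) (hr : IsEnd G (fun i => e (-i)) v al' l') {x y : V}
    {lam : Equiv.Perm V} (h : IsGluing G v w x y lam) (hy1 : y ≠ e (al : ℕ))
    (hy2 : y ≠ e (-(al' : ZMod c))) (hyl : y ≠ l) (hyr : y ≠ l') :
    ∃ s, (s = al ∨ s = al + 1) ∧ (4 - s = al' ∨ 4 - s = al' + 1) ∧
      ∃ lam', IsGluingAlong G v w (endVertex e al l s)
        (endVertex (fun i => e (-i)) al' l' (4 - s)) x y lam' := by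
  classical
  have p1 := hl.pos
  have p2 := hr.pos
  obtain ⟨hyrange, -⟩ := hG.leaf_of_isGluing hl hr h hy1 hy2 hyl hyr
  have hdeg : degAway G w x = 2 := by
    rw [hG.degAway_eq h, hG.degAway_eq_one hl hr h hy1 hy2]
  obtain ⟨j, rfl⟩ := hG.mem_range_of_isGluing h
  have hx : ∀ b, b ≠ w → (G.Adj (e j) b ↔ b = e (j + 1) ∨ b = e (j - 1)) := by
    have hsub : {e (j + 1), e (j - 1)} ⊆ (Finset.univ.erase w).filter (G.Adj (e j)) := by
      intro u hu
      simp only [Finset.mem_insert, Finset.mem_singleton] at hu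
      rw [mem_degAway_filter]
      rcases hu with rfl | rfl
      · exact ⟨hG.e_ne_w _, hG.adj_succ j⟩
      · exact ⟨hG.e_ne_w _, hG.adj_pred j⟩
    have heq := Finset.eq_of_subset_of_card_le hsub (by
      rw [Finset.card_pair (hG.succ_ne_pred j)]
      exact hdeg.le)
    intro b hb
    have h1 := Finset.ext_iff.1 heq b
    rw [mem_degAway_filter] at h1
    simp only [Finset.mem_insert, Finset.mem_singleton] at h1
    tauto
  have hkx : ∀ k : ℕ, 1 ≤ k → k < c → e (j + k) ≠ e j := fun k h1 h2 h' =>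
    zmod_natCast_ne_zero h1 h2 (add_eq_left.1 (hG.inj h'))
  -- Deleting x opens the cycle into a path on c - 1 vertices, and q is its image in G - v.
  let q : ℕ → V := fun k => lam (e (j + k))
  have hqv : ∀ k, 1 ≤ k → k < c → q k ≠ v := fun k h1 h2 h' =>
    hkx k h1 h2 (lam.injective (h'.trans h.map_x.symm))
  have hqy : ∀ k, 1 ≤ k → k < c → q k ≠ y := fun k _ _ h' =>
    hG.e_ne_w _ (lam.injective (h'.trans h.map_w.symm))
  have htrack : IsTrack G e v al al' q := by
    refine ⟨hqv, fun k h1 h2 => ?_, fun k k' _ h1 _ h2 h3 => ?_, fun i h1 h2 => ?_⟩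
    · refine (h.adj _ _ (hG.e_ne_w _) (hkx k h1 (by omega)) (hG.e_ne_w _)
        (hkx (k + 1) (by omega) h2)).1 ?_
      push_cast
      rw [← add_assoc]
      exact hG.adj_succ _
    · exact zmod_natCast_inj h1 h2 (add_left_cancel (hG.inj (lam.injective h3)))
    -- A spine vertex keeps two neighbours after y is deleted, so its preimage lies on the cycle and
    -- the path covers it.
    · obtain ⟨a, b, hab, hav, hbv, hay, hby, ha, hb⟩ :=
        hG.exists_pair_adj_of_spine hc hl hr h1 h2 hyl hyr hyrange
      have hev : e (i : ℕ) ≠ v := hG.natCast_ne_v (by omega) (by omega)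
      have hsw : ∀ {u}, u ≠ y → lam.symm u ≠ w := fun {u} hu h' => hu (by
        rw [← h.map_w, ← h', lam.apply_symm_apply])
      have hsx : ∀ {u}, u ≠ v → lam.symm u ≠ e j := fun {u} hu h' => hu (by
        rw [← h.map_x, ← h', lam.apply_symm_apply])
      have hey : e (i : ℕ) ≠ y := fun h' => hyrange ⟨_, h'⟩
      have hadj : ∀ {u}, u ≠ v → u ≠ y → G.Adj (e (i : ℕ)) u →
          G.Adj (lam.symm (e (i : ℕ))) (lam.symm u) := by
        intro u huv huy hu
        rw [h.adj _ _ (hsw hey) (hsx hev) (hsw huy) (hsx huv), lam.apply_symm_apply,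
          lam.apply_symm_apply]
        exact hu
      obtain ⟨m, hm⟩ := hG.mem_range_of_pair_adj (fun h' => hab (lam.symm.injective h'))
        (hadj hav hay ha) (hadj hbv hby hb)
      have : NeZero c := ⟨by omega⟩
      have hcast : (((m - j).val : ℕ) : ZMod c) = m - j := ZMod.natCast_zmod_val _
      refine ⟨(m - j).val, ?_, ZMod.val_lt _, ?_⟩
      · rw [Nat.one_le_iff_ne_zero, ne_eq, ZMod.val_eq_zero, sub_eq_zero]
        rintro rfl
        exact hsx hev hm.symm
      · change lam (e (j + _)) = _
        rw [hcast, add_sub_cancel, hm, lam.apply_symm_apply]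
  have hlast : lam (e (j - 1)) = q (c - 1) := by
    change _ = lam (e (j + _))
    rw [Nat.cast_sub (by omega), ZMod.natCast_self]
    congr 2
    push_cast
    ring
  have hone : lam (e (j + 1)) = q 1 := by
    change _ = lam (e (j + _))
    rw [Nat.cast_one]
  rcases htrack.exists_isIncreasing hG hc hl hr with ⟨s, hs⟩ | ⟨s, hs⟩
  · exact ⟨s, h.exists_isGluingAlong hG hc hl hr hyl hyr hx htrack hs hqy hone hlast⟩
  -- For a path running from right to left the two neighbours of x exchange roles.
  · refine ⟨s, h.exists_isGluingAlong hG hc hl hr hyl hyr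
      (fun b hb => (hx b hb).trans or_comm) htrack.reverse hs
      (fun k h1 h2 => hqy (c - k) (by omega) (by omega)) hlast ?_⟩
    rw [hone]
    congr 1
    omega

end Classify

/-! ### Counting matched pairs -/

section Main
variable {V : Type u} [Fintype V] {G : SimpleGraph V} {c : ℕ} {e : ZMod c → V} {v w : V}
  {z : ZMod c} {al al' : ℕ} {l l' : V}

omit [Fintype V] in
theorem endVertex_eq_or (e : ZMod c → V) (al : ℕ) (l : V) (s : ℕ) :
    endVertex e al l s = l ∨ endVertex e al l s = e (al : ℕ) := by
  unfold endVertex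
  split_ifs <;> simp

/-- Pairs glued along one standard type are no more than `chi` for the best supercard. -/
theorem IsPointed.card_type_le {A B : Type u} {U : SimpleGraph A} {T : SimpleGraph B}
    (hG : IsPointed G e v w z) (hsuper : IsSupercardAt U T G v w)
    (hmax : ∀ (W : Type u) [Fintype W] (H : SimpleGraph W) (v' w' : W),
      IsSunshine H → IsSupercardAt U T H v' w' → chi H v' w' ≤ chi G v w)
    (hc : 14 ≤ c) (hl : IsEnd G e v al l) (hr : IsEnd G (fun i => e (-i)) v al' l') {s : ℕ}
    {M : Finset (V × V)} (h1 : ∀ m ∈ M, ∀ m' ∈ M, m.1 = m'.1 → m = m')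
    (h2 : ∀ m ∈ M, ∀ m' ∈ M, m.2 = m'.2 → m = m')
    (hM : ∀ m ∈ M, (m.2 ≠ e (al : ℕ) ∧ m.2 ≠ e (-(al' : ZMod c)) ∧ m.2 ≠ l ∧ m.2 ≠ l') ∧
      ∃ lam, IsGluingAlong G v w (endVertex e al l s)
        (endVertex (fun i => e (-i)) al' l' (4 - s)) m.1 m.2 lam) : M.card ≤ chi G v w := by
  rcases M.eq_empty_or_nonempty with rfl | ⟨m₀, hm₀⟩
  · simp
  have hp := hG.endVertex_ne_v hl s
  have hq := hG.neg.endVertex_ne_v hr (4 - s)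
  refine (card_le_chi_rejoin hp hq (fun m hm => (hM m hm).2) h1 h2 hm₀).trans ?_
  obtain ⟨⟨hy1, hy2, hy3, hy4⟩, lam, hlam⟩ := hM m₀ hm₀
  obtain ⟨hyr, i, hi, hi', ht⟩ :=
    hG.leaf_of_isGluing hl hr hlam.toIsGluing hy1 hy2 hy3 hy4
  have := hl.pos
  have := hr.pos
  refine hmax V _ v m₀.2 (IsFrame.isSunshine (hlam.isFrame hG hp hq ht
    (hG.natCast_ne_v (by omega) (by omega)) ?_ ?_ ?_)) (hlam.isSupercardAt hsuper hp hq)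
  · rcases endVertex_eq_or e al l s with h | h <;> rw [h] <;> assumption
  · rcases endVertex_eq_or (fun i => e (-i)) al' l' (4 - s) with h | h <;> rw [h] <;> assumption
  · exact hG.exists_pair_adj_of_spine hc hl hr hi hi' hy3 hy4 hyr

theorem IsEnd.pendants_eq_empty (hl : IsEnd G e v al l) (h : al ≠ 1) : pendants G e 1 = ∅ := by
  rcases hl.cases with ⟨h1, -⟩ | ⟨-, h1, -⟩
  · exact absurd h1 h
  · rw [Finset.eq_empty_iff_forall_notMem]
    intro u hu
    rw [mem_pendants] at hu
    exact hu.1 (h1 u hu.2)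

/-- The number of matched pairs in terms of `chi`. -/
theorem IsPointed.card_matching_le {A B : Type u} {U : SimpleGraph A} {T : SimpleGraph B}
    (hG : IsPointed G e v w z) (hsuper : IsSupercardAt U T G v w)
    (hmax : ∀ (W : Type u) [Fintype W] (H : SimpleGraph W) (v' w' : W),
      IsSunshine H → IsSupercardAt U T H v' w' → chi H v' w' ≤ chi G v w)
    (hc : 14 ≤ c) (hl : IsEnd G e v al l) (hr : IsEnd G (fun i => e (-i)) v al' l')
    {M : Finset (V × V)} (hM : ∀ m ∈ M, ∃ lam, IsGluing G v w m.1 m.2 lam)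
    (h1 : ∀ m ∈ M, ∀ m' ∈ M, m.1 = m'.1 → m = m')
    (h2 : ∀ m ∈ M, ∀ m' ∈ M, m.2 = m'.2 → m = m') :
    M.card ≤ 4 + 2 * chi G v w ∧ (al = 1 → al' = 1 → M.card ≤ 4 + chi G v w) := by
  classical
  let P : ℕ → V × V → Prop := fun s m =>
    (m.2 ≠ e (al : ℕ) ∧ m.2 ≠ e (-(al' : ZMod c)) ∧ m.2 ≠ l ∧ m.2 ≠ l') ∧
      (4 - s = al' ∨ 4 - s = al' + 1) ∧ ∃ lam, IsGluingAlong G v w (endVertex e al l s)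
        (endVertex (fun i => e (-i)) al' l' (4 - s)) m.1 m.2 lam
  let E : Finset V := {e (al : ℕ), e (-(al' : ZMod c)), l, l'}
  have hE : (M.filter fun m => m.2 ∈ E).card ≤ 4 := by
    refine (Finset.card_le_card_of_injOn Prod.snd (fun m hm => ?_) ?_).trans
      (Finset.card_le_four : E.card ≤ 4)
    · exact (Finset.mem_filter.1 hm).2
    · intro m hm m' hm' h
      exact h2 m (Finset.mem_filter.1 hm).1 m' (Finset.mem_filter.1 hm').1 h
  have hP : ∀ s, (M.filter (P s)).card ≤ chi G v w := by
    intro s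
    refine hG.card_type_le hsuper hmax hc hl hr (s := s) (M := M.filter (P s)) ?_ ?_ ?_
    · exact fun m hm m' hm' => h1 m (Finset.mem_filter.1 hm).1 m' (Finset.mem_filter.1 hm').1
    · exact fun m hm m' hm' => h2 m (Finset.mem_filter.1 hm).1 m' (Finset.mem_filter.1 hm').1
    · intro m hm
      have := (Finset.mem_filter.1 hm).2
      exact ⟨this.1, this.2.2⟩
  have hcov : M ⊆ (M.filter fun m => m.2 ∈ E) ∪ (M.filter (P al) ∪ M.filter (P (al + 1))) := by
    intro m hm
    simp only [Finset.mem_union, Finset.mem_filter]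
    by_cases hmE : m.2 ∈ E
    · exact Or.inl ⟨hm, hmE⟩
    · right
      simp only [E, Finset.mem_insert, Finset.mem_singleton, not_or] at hmE
      obtain ⟨lam, hlam⟩ := hM m hm
      obtain ⟨s, rfl | rfl, hs', hs⟩ :=
        hG.classify hc hl hr hlam hmE.1 hmE.2.1 hmE.2.2.1 hmE.2.2.2
      · exact Or.inl ⟨hm, hmE, hs', hs⟩
      · exact Or.inr ⟨hm, hmE, hs', hs⟩
  have hcard := (Finset.card_le_card hcov).trans ((Finset.card_union_le _ _).trans
    (add_le_add_right (Finset.card_union_le _ _) _))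
  have ha := hP al
  have hb := hP (al + 1)
  refine ⟨by omega, fun hal hal' => ?_⟩
  -- With al = al' = 1, the value s = 1 would need 4 - s = 3 to be 1 or 2; only s = 2 remains.
  have h0 : (M.filter (P al)).card = 0 := by
    rw [Finset.card_eq_zero, Finset.filter_eq_empty_iff]
    intro m _ hm
    have := hm.2.1
    omega
  omega

omit [Fintype V] in
theorem IsFrame.card_le_of_fst_mem (h : IsFrame G e) {M : Finset (V × V)}
    (hM : ∀ m ∈ M, m.1 ∈ Set.range e) (h1 : ∀ m ∈ M, ∀ m' ∈ M, m.1 = m'.1 → m = m') :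
    M.card ≤ c := by
  classical
  have : NeZero c := ⟨by have := h.three_le; omega⟩
  have h2 : M.card ≤ (Finset.univ.image e).card :=
    Finset.card_le_card_of_injOn Prod.fst
      (fun m hm => by
        obtain ⟨i, hi⟩ := hM m hm
        exact Finset.mem_coe.2 (Finset.mem_image.2 ⟨i, Finset.mem_univ _, hi⟩))
      (fun m hm m' hm' h => h1 m hm m' hm' h)
  refine h2.trans (Finset.card_image_le.trans ?_)
  rw [Finset.card_univ, ZMod.card]

theorem card_eq_add_one_of_card_iso {A : Type u} [Fintype A] {U : SimpleGraph A}
    (eU : card G w ≃g U) : Fintype.card V = Fintype.card A + 1 := by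
  have h1 : Nat.card ({w}ᶜ : Set V) = Nat.card A := Nat.card_congr eU.toEquiv
  rw [Nat.card_coe_set_eq, Set.ncard_compl, Set.ncard_singleton, Nat.card_eq_fintype_card,
    Nat.card_eq_fintype_card] at h1
  have : 0 < Fintype.card V := Fintype.card_pos_iff.2 ⟨w⟩
  omega

end Main

end Supercard

theorem mainTheorem4 {A B V : Type u} [Fintype A] [Fintype B] [Fintype V]
    (U : SimpleGraph A) (T : SimpleGraph B) (Uplus : SimpleGraph V) (v w : V)
    (hU : Supercard.IsSunshine U) (hT : Supercard.IsCaterpillar T)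
    (hUplus : Supercard.IsSunshine Uplus)
    (hsuper : Supercard.IsSupercardAt U T Uplus v w)
    (hmax : ∀ (W : Type u) [Fintype W] (H : SimpleGraph W) (v' w' : W),
      Supercard.IsSunshine H → Supercard.IsSupercardAt U T H v' w' →
        Supercard.chi H v' w' ≤ Supercard.chi Uplus v w)
    (n : ℕ) (hn : Fintype.card A = n) (hn12 : 12 ≤ n)
    (hne : Supercard.activePermsCard Uplus v w ≠ Supercard.autPerms Uplus) :
    Supercard.commonCards U T ≤ 2 * ⌊Real.sqrt (2 * (n : ℝ) + 1)⌋₊ + 3 := by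
  obtain ⟨c, e₀, he₀⟩ := hUplus.exists_frame
  obtain ⟨e, z, hG⟩ := he₀.exists_isPointed hU hT hsuper
  obtain ⟨M, hcard, hM, h1, h2⟩ := Supercard.exists_gluing_matching hsuper
  rw [← hcard]
  have hV : Fintype.card V = n + 1 := by
    obtain ⟨eU⟩ := hsuper.card_left
    rw [Supercard.card_eq_add_one_of_card_iso eU, hn]
  have h5 : 5 ≤ ⌊Real.sqrt (2 * (n : ℝ) + 1)⌋₊ := Supercard.le_floor_sqrt (by omega)
  -- On a short cycle the number of choices for x is enough: at most 13 = 2 · 5 + 3, with 5 ≤ ⌊√(2n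
  -- + 1)⌋.
  rcases Nat.lt_or_ge c 14 with hc | hc
  · have := hG.toIsFrame.card_le_of_fst_mem (M := M) (fun m hm => by
      obtain ⟨lam, hlam⟩ := hM m hm
      exact hG.mem_range_of_isGluing hlam) h1
    omega
  · obtain ⟨al, l, hl⟩ := hG.exists_isEnd
    obtain ⟨al', l', hr⟩ := hG.neg.exists_isEnd
    obtain ⟨h3, h4⟩ := hG.card_matching_le hsuper hmax hc hl hr hM h1 h2
    by_cases hal : al = 1
    · by_cases hal' : al' = 1
      -- Without the saving in χ a single type occurs, and 4 + χ fits because the floor is at least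
      -- 5.
      · have := h4 hal hal'
        have := hG.chi_le hne hV hn12
        omega
      -- Here e (-1) has no pendant, so the reflected frame yields χ + 1 ≤ ⌊√(2n + 1)⌋ and 4 + 2χ is
      -- within the bound.
      · have := hG.neg.chi_add_one_le hne hV hn12 (hr.pendants_eq_empty hal')
        omega
    · have := hG.chi_add_one_le hne hV hn12 (hl.pendants_eq_empty hal)
      omega
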